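/- Let $f\in\mathbb R[x_1,\dots,x_n]$ be homogeneous of degree $d\ge 1$ and hyperbolic with respect to $e\in\mathbb R^n$ (that is, $f(e)\neq 0$ and for every $a\in\mathbb R^n$ all roots of $f(te+a)\in\mathbb R[t]$ are real), with $f(e)>0$. Write $\mathbb R[x]_k$ for the space of real forms of degree $k$, including $0$, and $D_e=\sum_i e_i\,\partial/\partial x_i$. For nonzero univariate real polynomials $p,q$ with only real roots $\alpha_1\le\dots\le\alpha_m$ and $\beta_1\le\dots\le\beta_{m-1}$ (listed with multiplicity, $\deg q=\deg p-1$), say that $q$ interlaces $p$ if $\alpha_i\le\beta_i\le\alpha_{i+1}$ for all $i$. Let $\mathrm{Int}(f,e)$ be the set of $g\in\mathbb R[x]_{\deg f-1}$ with $g(e)>0$ such that $g(te+a)$ interlaces $f(te+a)$ for every $a\in\mathbb R^n$, and put $\mathrm{Int}_0(f,e)=\mathrm{Int}(f,e)\cup\{0\}$. A section of the cone of nonnegative forms of degree $k$ is its intersection with a linear subspace of $\mathbb R[x]_k$; a cone is linearly isomorphic to such a section if some injective linear map on its linear span carries it onto the section. 1. $\mathrm{Int}_0(f,e)$ is a closed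 convex cone in $\mathbb R[x]_{d-1}$. 2. If $f$ is square-free, then $$\mathrm{Int}_0(f,e)=\{h\in\mathbb R[x]_{d-1} : D_ef\cdot h-f\cdot D_eh\ge 0\text{ on }\mathbb R^n\}.$$ Moreover $h\mapsto D_ef\cdot h-f\cdot D_eh$ is an injective linear map $\Phi:\mathbb R[x]_{d-1}\to\mathbb R[x]_{2d-2}$, and it maps $\mathrm{Int}_0(f,e)$ onto the intersection of the cone of nonnegative forms of degree $2d-2$ with the linear subspace $\Phi(\mathbb R[x]_{d-1})$. In particular, $\mathrm{Int}_0(f,e)$ is linearly isomorphic to a section of the cone of nonnegative forms of degree $2d-2$. 3. If $f=f_1\cdot f_2$ with $f_1,f_2\in\mathbb R[x_1,\dots,x_n]$, where $f$ and $f_2$ have the same zero set in $\mathbb C^n$, $f_2$ is square-free and $f_2(e)>0$, then $$\mathrm{Int}(f,e)=f_1\cdot\mathrm{Int}(f_2,e),\qquad \mathrm{Int}_0(f,e)=f_1\cdot\mathrm{Int}_0(f_2,e),$$ and $\mathrm{Int}_0(f,e)$ is linearly isomorphic to a section of the cone of nonnegative forms of degree $2\deg(f_2)-2$. -/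

import Mathlib

open MvPolynomial

/-- The polynomial `f(t e + a)` in the single variable `t`. -/
noncomputable def restrictToLine {n : ℕ} (f : MvPolynomial (Fin n) ℝ) (e a : Fin n → ℝ) :
    Polynomial ℝ :=
  aeval (fun i => Polynomial.X * Polynomial.C (e i) + Polynomial.C (a i)) f

/-- A real form `f` is hyperbolic with respect to `e` if `f(e) ≠ 0` and, for every `a ∈ ℝⁿ`,
the polynomial `f(t e + a)` has only real zeros. -/
def IsHyperbolic {n : ℕ} (f : MvPolynomial (Fin n) ℝ) (e : Fin n → ℝ) : Prop :=
  (∃ d, f.IsHomogeneous d) ∧ eval e f ≠ 0 ∧ ∀ a : Fin n → ℝ, (restrictToLine f e a).Splits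

/-- Univariate interlacing: `f` and `g` are nonzero and have only real zeros, listed with
multiplicity as `α₀ ≤ ⋯ ≤ αₘ` and `β₀ ≤ ⋯ ≤ βₘ₋₁` (so `deg g = deg f - 1`), and
`αᵢ ≤ βᵢ ≤ αᵢ₊₁` for all `i`. -/
def UnivInterlaces (g f : Polynomial ℝ) : Prop :=
  f ≠ 0 ∧ g ≠ 0 ∧
  ∃ (m : ℕ) (α : Fin (m + 1) → ℝ) (β : Fin m → ℝ),
    Monotone α ∧ Monotone β ∧
    f = Polynomial.C f.leadingCoeff * ∏ i, (Polynomial.X - Polynomial.C (α i)) ∧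
    g = Polynomial.C g.leadingCoeff * ∏ i, (Polynomial.X - Polynomial.C (β i)) ∧
    ∀ i : Fin m, α i.castSucc ≤ β i ∧ β i ≤ α i.succ

/-- `g` is homogeneous of degree `deg f - 1` and `g(t e + a)` interlaces `f(t e + a)` for every
`a ∈ ℝⁿ`. -/
def InterlacesAt {n : ℕ} (g f : MvPolynomial (Fin n) ℝ) (e : Fin n → ℝ) : Prop :=
  g.IsHomogeneous (f.totalDegree - 1) ∧
  ∀ a : Fin n → ℝ, UnivInterlaces (restrictToLine g e a) (restrictToLine f e a)

/-- The set `Int(f, e)` of interlacers of `f` with respect to `e` that are positive at `e`. -/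
def interlacers {n : ℕ} (f : MvPolynomial (Fin n) ℝ) (e : Fin n → ℝ) :
    Set (MvPolynomial (Fin n) ℝ) :=
  {g | InterlacesAt g f e ∧ 0 < eval e g}

/-- `Int(f, e)` together with its apex, the zero polynomial. -/
def interlacerCone {n : ℕ} (f : MvPolynomial (Fin n) ℝ) (e : Fin n → ℝ) :
    Set (MvPolynomial (Fin n) ℝ) :=
  insert 0 (interlacers f e)

/-- The directional derivative `D_e f = ∑ eᵢ ∂f/∂xᵢ`. -/
noncomputable def dirDeriv {n : ℕ} (e : Fin n → ℝ) (f : MvPolynomial (Fin n) ℝ) :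
    MvPolynomial (Fin n) ℝ :=
  ∑ i, e i • pderiv i f

/-- The space `ℝ[x]_k` of real forms of degree `k` (including zero). -/
abbrev Forms (n k : ℕ) : Type := homogeneousSubmodule (Fin n) ℝ k

/-- The topology of `ℝ[x]_k` as a finite-dimensional real vector space: coefficientwise
convergence. -/
instance Forms.instTopologicalSpace (n k : ℕ) : TopologicalSpace (Forms n k) :=
  TopologicalSpace.induced
    (fun (p : Forms n k) (m : Fin n →₀ ℕ) => coeff m (p : MvPolynomial (Fin n) ℝ)) inferInstance

/-- The cone of forms of degree `k` that are nonnegative on `ℝⁿ`. -/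
def nonnegForms (n k : ℕ) : Set (Forms n k) :=
  {p | ∀ x : Fin n → ℝ, 0 ≤ eval x (p : MvPolynomial (Fin n) ℝ)}

/-- A set `S` of polynomials is linearly isomorphic to a section (the intersection with a linear
subspace) of the cone of nonnegative forms of degree `k`: some injective linear map on the linear
span of `S` carries `S` onto such a section. -/
def IsIsoToNonnegSection {n : ℕ} (S : Set (MvPolynomial (Fin n) ℝ)) (k : ℕ) : Prop :=
  ∃ (L : Submodule ℝ (Forms n k)) (Φ : Submodule.span ℝ S →ₗ[ℝ] Forms n k),
    Function.Injective Φ ∧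
    Φ '' {h | (h : MvPolynomial (Fin n) ℝ) ∈ S} = nonnegForms n k ∩ (L : Set (Forms n k))

/-- The complex hypersurface `V(f) ⊆ ℂⁿ` of a real polynomial. -/
def complexZeros {n : ℕ} (f : MvPolynomial (Fin n) ℝ) : Set (Fin n → ℂ) :=
  {z | aeval z f = 0}

/-! On a line `t e + a` interlacing is a statement about partial fractions. If `p` is real-rooted,
`deg q = deg p - 1` and both leading coefficients are positive, then `q` interlaces `p` exactly when
`q / p = ∑ cᵢ / (t - αᵢ)` with all `cᵢ ≥ 0`. This in turn is equivalent to `Im (q(z) * conj p(z)) ≤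
0` on the upper half plane (`univInterlaces_iff_halfPlaneNonpos`). For fixed `z` the last condition
is closed and linear in `q`, so the cone is an intersection of closed half-spaces. Zero is the only
point of this intersection outside `Int(f, e)`: `g(e) = f(e) * ∑ cᵢ`, so `g(e) = 0` kills every
`cᵢ`, on every line.

Differentiating the partial fractions gives `p' q - p q' = ∑ cᵢ p² / (t - αᵢ)² ≥ 0`. Conversely, at
a simple root of `p` the Wronskian equals `p' q`, so its sign is that of the residue. A square-free
`f` has only simple roots on a dense set of lines, and the half plane condition passes to the limit
(`halfPlaneNonpos_of_wronskian_nonneg`). If the Wronskian of `h` vanishes, both `h` and `-h` lie in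
the cone, so `h(e) = 0` and `h = 0`.

For `f = f₁ f₂`, each zero of `f₁` is a zero of `f₂`. On a line an interlacer loses at most one
order of vanishing against `f`, so it is divisible by `f₁`; division over the generic line makes
this global. Cancelling `f₁` changes the half plane expression only by the positive factor `|f₁|²`.
-/

namespace Polynomial

/-! ### Nonnegative residues, partial fractions and the half plane condition -/

/-- The local condition at the roots of `p` that characterizes interlacing: `q` vanishes at a root
of `p` of multiplicity `k + 1` to order at least `k`, and `q / p` has nonnegative residue there. -/
def ResidueNonneg (q p : ℝ[X]) : Prop :=
  ∀ (a : ℝ) (k : ℕ) (p₁ : ℝ[X]), p = (X - C a) ^ (k + 1) * p₁ → p₁.eval a ≠ 0 →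
    ∃ q₁ : ℝ[X], q = (X - C a) ^ k * q₁ ∧ 0 ≤ q₁.eval a * p₁.eval a

/-- `q / p` maps the open upper half plane to the closed lower half plane, up to zeros of `p`. -/
def HalfPlaneNonpos (q p : ℝ[X]) : Prop :=
  ∀ z : ℂ, 0 < z.im → (aeval z q * (starRingEnd ℂ) (aeval z p)).im ≤ 0

/-- `q` is a nonnegative combination of the quotients of `p` by its linear factors. -/
inductive QuotientComb : ℝ[X] → ℝ[X] → Prop
  | base (b : ℝ) : QuotientComb 0 (C b)
  | step (a c : ℝ) (q p : ℝ[X]) (hc : 0 ≤ c) (h : QuotientComb q p) :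
      QuotientComb (C c * p + (X - C a) * q) ((X - C a) * p)

lemma pow_X_sub_C_mul_unique {a : ℝ} {j k : ℕ} {u v : ℝ[X]}
    (h : (X - C a) ^ j * u = (X - C a) ^ k * v) (hu : u.eval a ≠ 0) (hv : v.eval a ≠ 0) :
    j = k ∧ u = v := by
  have key : ∀ {j k : ℕ} {u v : ℝ[X]}, (X - C a) ^ j * u = (X - C a) ^ k * v →
      v.eval a ≠ 0 → j ≤ k := by
    intro j k u v h hv
    by_contra! hlt
    obtain ⟨l, rfl⟩ := Nat.exists_eq_add_of_lt hlt
    have h' : (X - C a) ^ k * ((X - C a) ^ (l + 1) * u) = (X - C a) ^ k * v := by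
      rw [← h]; ring
    have := mul_left_cancel₀ (pow_ne_zero _ (X_sub_C_ne_zero a)) h'
    apply hv
    rw [← this]
    simp
  have hjk : j = k := le_antisymm (key h hv) (key h.symm hu)
  subst hjk
  exact ⟨rfl, mul_left_cancel₀ (pow_ne_zero _ (X_sub_C_ne_zero a)) h⟩

lemma exists_X_sub_C_mul_of_eval_eq_zero {a : ℝ} {p : ℝ[X]} (h : p.eval a = 0) :
    ∃ q, p = (X - C a) * q := dvd_iff_isRoot.mpr h

lemma exists_pow_X_sub_C_mul {p : ℝ[X]} (hp : p ≠ 0) (a : ℝ) :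
    ∃ (k : ℕ) (p₁ : ℝ[X]), p = (X - C a) ^ k * p₁ ∧ p₁.eval a ≠ 0 := by
  obtain ⟨p₁, h, h'⟩ := p.exists_eq_pow_rootMultiplicity_mul_and_not_dvd hp a
  exact ⟨_, p₁, h, fun h0 => h' (dvd_iff_isRoot.mpr h0)⟩

lemma exists_pow_succ_X_sub_C_mul {p : ℝ[X]} (hp : p ≠ 0) {a : ℝ} (ha : p.eval a = 0) :
    ∃ (k : ℕ) (p₁ : ℝ[X]), p = (X - C a) ^ (k + 1) * p₁ ∧ p₁.eval a ≠ 0 := by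
  obtain ⟨k, p₁, h, h1⟩ := exists_pow_X_sub_C_mul hp a
  cases k with
  | zero => exact absurd (by simpa [h] using ha) h1
  | succ k => exact ⟨k, p₁, h, h1⟩

lemma coprime_pow_X_sub_C {a b : ℝ} (h : a ≠ b) (k : ℕ) :
    IsCoprime ((X - C a) ^ k) (X - C b) :=
  (isCoprime_X_sub_C_of_isUnit_sub (sub_ne_zero.mpr h).isUnit).pow_left

lemma degree_C_mul_le_degree (c : ℝ) (p : ℝ[X]) : (C c * p).degree ≤ p.degree := by
  rw [← smul_eq_C_mul]; exact degree_smul_le c p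

lemma X_sub_C_mul_degree_lt_iff {a : ℝ} {q p : ℝ[X]} :
    ((X - C a) * q).degree < ((X - C a) * p).degree ↔ q.degree < p.degree := by
  rw [degree_mul, degree_mul, degree_X_sub_C]
  exact WithBot.add_lt_add_iff_left (by simp)

/-- Each `c / (z - a)` with `c ≥ 0` has nonpositive imaginary part for `Im z > 0`; the induction
adds one such term to `q / p`. -/
lemma QuotientComb.halfPlaneNonpos {q p : ℝ[X]} (h : QuotientComb q p) :
    HalfPlaneNonpos q p := by
  induction h with
  | base b => intro z hz; simp
  | step a c q p hc h ih =>
    intro z hz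
    have := ih z hz
    simp only [map_add, map_mul, map_sub, aeval_C, aeval_X]
    set P := aeval z p
    set Q := aeval z q
    have e : (algebraMap ℝ ℂ) = Complex.ofRealHom := rfl
    simp only [e, Complex.ofRealHom_eq_coe, Complex.conj_ofReal, Complex.mul_im, Complex.add_im,
      Complex.add_re, Complex.mul_re, Complex.sub_im, Complex.sub_re, Complex.conj_re,
      Complex.conj_im, Complex.ofReal_re, Complex.ofReal_im] at this ⊢
    have h1 : 0 ≤ c * z.im * (P.re ^ 2 + P.im ^ 2) := by positivity
    have h2 : 0 ≤ ((z.re - a) ^ 2 + z.im ^ 2) * (-(Q.re * -P.im + Q.im * P.re)) :=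
      mul_nonneg (by positivity) (by linarith)
    nlinarith [h1, h2]

/-- The Wronskian is `-p² (q / p)'`, and `-(c / (x - a))' = c / (x - a)²`; clearing denominators
gives the recursion in `e`. -/
lemma QuotientComb.wronskian_nonneg {q p : ℝ[X]} (h : QuotientComb q p) (x : ℝ) :
    0 ≤ (derivative p * q - p * derivative q).eval x := by
  induction h with
  | base b => simp
  | step a c q p hc h ih =>
    have e : derivative ((X - C a) * p) * (C c * p + (X - C a) * q) -
        (X - C a) * p * derivative (C c * p + (X - C a) * q) =
        C c * p ^ 2 + (X - C a) ^ 2 * (derivative p * q - p * derivative q) := by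
      simp only [derivative_mul, derivative_add, derivative_sub, derivative_X, derivative_C]
      ring
    rw [e]
    simp only [eval_add, eval_mul, eval_pow, eval_C] at ih ⊢
    have := ih
    positivity

lemma QuotientComb.degree_lt {q p : ℝ[X]} (h : QuotientComb q p) (hp : p ≠ 0) :
    q.degree < p.degree := by
  induction h with
  | base b => simpa [bot_lt_iff_ne_bot] using hp
  | step a c q p hc h ih =>
    have hp0 : p ≠ 0 := right_ne_zero_of_mul hp
    have h1 : p.degree < ((X - C a) * p).degree := by
      rw [degree_mul, degree_X_sub_C, degree_eq_natDegree hp0]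
      exact_mod_cast (by omega : p.natDegree < 1 + p.natDegree)
    refine (degree_add_le _ _).trans_lt (max_lt ?_ ?_)
    · exact (degree_C_mul_le_degree c p).trans_lt h1
    · exact X_sub_C_mul_degree_lt_iff.mpr (ih hp0)

/-- The coefficient in question is the leading coefficient of `p` times the sum of the `c`'s, so it
vanishes only if all of them do. -/
lemma QuotientComb.coeff_mul_leadingCoeff {q p : ℝ[X]} (h : QuotientComb q p) {n : ℕ}
    (hn : p.natDegree = n + 1) :
    0 ≤ q.coeff n * p.leadingCoeff ∧ (q.coeff n = 0 → q = 0) := by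
  induction h generalizing n with
  | base b => simp at hn
  | step a c q p hc h ih =>
    have hp : p ≠ 0 := by rintro rfl; simp at hn
    have hdp : p.natDegree = n := by
      rw [natDegree_mul (X_sub_C_ne_zero a) hp, natDegree_X_sub_C] at hn; omega
    have hq0 : q.coeff n = 0 := by
      apply coeff_eq_zero_of_degree_lt
      rw [← hdp, ← degree_eq_natDegree hp]
      exact h.degree_lt hp
    have hl : p.coeff n = p.leadingCoeff := by rw [← hdp]; rfl
    have hl0 : p.leadingCoeff ≠ 0 := leadingCoeff_ne_zero.mpr hp
    rw [leadingCoeff_mul, leadingCoeff_X_sub_C, one_mul]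
    cases n with
    | zero =>
      have hq : q = 0 := by
        have := h.degree_lt hp
        rw [degree_eq_natDegree hp, hdp] at this
        simpa [Nat.WithBot.lt_zero_iff] using this
      subst hq
      simp only [mul_zero, add_zero, coeff_C_mul, hl]
      refine ⟨by nlinarith [mul_nonneg hc (sq_nonneg p.leadingCoeff)], fun h0 => ?_⟩
      have : c = 0 := by simpa [hl0] using h0
      simp [this]
    | succ n =>
      obtain ⟨i1, i2⟩ := ih hdp
      have e : (C c * p + (X - C a) * q).coeff (n + 1) = c * p.leadingCoeff + q.coeff n := by
        rw [coeff_add, coeff_C_mul, hl, sub_mul, coeff_sub, coeff_X_mul, coeff_C_mul, hq0]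
        ring
      rw [e]
      have h1 := mul_nonneg hc (sq_nonneg p.leadingCoeff)
      refine ⟨by nlinarith, fun h0 => ?_⟩
      have h2 : c * p.leadingCoeff ^ 2 = 0 := by
        have h5 : c * p.leadingCoeff ^ 2 + q.coeff n * p.leadingCoeff = 0 := by
          linear_combination p.leadingCoeff * h0
        linarith
      have h3 : c = 0 := by simpa [hl0] using h2
      have h4 : q.coeff n = 0 := by simpa [h3] using h0
      simp [h3, i2 h4]

/-- Partial fractions, one root at a time: subtracting `c / (X - a)` from `q / p`, with `c` the
residue at `a`, lowers the degree of `p` and keeps the residue condition. -/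
lemma ResidueNonneg.quotientComb {q p : ℝ[X]} (h : ResidueNonneg q p) (hs : p.Splits)
    (hd : q.degree < p.degree) : QuotientComb q p := by
  induction hn : p.natDegree generalizing p q with
  | zero =>
    rw [eq_C_of_natDegree_eq_zero hn] at hd ⊢
    have : q = 0 := by
      have := hd.trans_le degree_C_le
      simpa [Nat.WithBot.lt_zero_iff] using this
    rw [this]
    exact .base _
  | succ n ih =>
    have hp : p ≠ 0 := by rintro rfl; simp at hn
    obtain ⟨a, ha⟩ := hs.exists_eval_eq_zero (by
      rw [degree_eq_natDegree hp, hn]; exact_mod_cast n.succ_ne_zero)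
    obtain ⟨k, p₁, hp₁, hp₁a⟩ := exists_pow_succ_X_sub_C_mul hp ha
    obtain ⟨q₁, hq₁, hq₁a⟩ := h a k p₁ hp₁ hp₁a
    set c := q₁.eval a / p₁.eval a with hc
    have hc0 : 0 ≤ c := by
      rw [hc, ← mul_div_mul_right _ _ hp₁a]
      exact div_nonneg hq₁a (mul_self_nonneg _)
    obtain ⟨q₂, hq₂⟩ := exists_X_sub_C_mul_of_eval_eq_zero (a := a) (p := q₁ - C c * p₁) (by
      simp [hc, div_mul_cancel₀ _ hp₁a])
    set p₀ := (X - C a) ^ k * p₁ with hp₀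
    set r := (X - C a) ^ k * q₂ with hr
    have e1 : p = (X - C a) * p₀ := by rw [hp₁, hp₀]; ring
    have e2 : q = C c * p₀ + (X - C a) * r := by
      rw [hq₁, hp₀, hr]; linear_combination (X - C a) ^ k * hq₂
    have hp₀0 : p₀ ≠ 0 := by rintro h0; rw [h0, mul_zero] at e1; exact hp e1
    have hdp₀ : p₀.natDegree = n := by
      rw [e1, natDegree_mul (X_sub_C_ne_zero a) hp₀0, natDegree_X_sub_C] at hn; omega
    have hlt : p₀.degree < p.degree := by
      rw [degree_eq_natDegree hp, degree_eq_natDegree hp₀0, hn, hdp₀]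
      exact_mod_cast n.lt_succ_self
    have hdr : r.degree < p₀.degree := by
      have : ((X - C a) * r).degree < ((X - C a) * p₀).degree := by
        rw [← e1, show (X - C a) * r = q - C c * p₀ by rw [e2]; ring]
        exact (degree_sub_le _ _).trans_lt (max_lt hd ((degree_C_mul_le_degree c p₀).trans_lt hlt))
      exact X_sub_C_mul_degree_lt_iff.mp this
    rw [e1, e2]
    refine .step a c r p₀ hc0 (ih ?_ ?_ hdr hdp₀)
    · intro b j u hu hub
      -- At `a` itself the residue has just been removed, so what is left is zero; at any other root
      -- the subtracted term has no pole and the residue is unchanged.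
      by_cases hb : b = a
      · subst hb
        rw [hp₀] at hu
        obtain ⟨hk, rfl⟩ := pow_X_sub_C_mul_unique hu hp₁a hub
        refine ⟨(X - C b) * q₂, by rw [hr, hk]; ring, by simp⟩
      · have hba : b - a ≠ 0 := sub_ne_zero.mpr hb
        obtain ⟨v, hv, hvb⟩ := h b j ((X - C a) * u) (by rw [e1, hu]; ring)
          (by simpa using ⟨hba, hub⟩)
        have e3 : (X - C a) * r = (X - C b) ^ j * (v - C c * ((X - C b) * u)) := by
          have : (X - C a) * r = q - C c * p₀ := by rw [e2]; ring
          rw [this, hv, hu]; ring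
        obtain ⟨s, hs'⟩ := (coprime_pow_X_sub_C hb j).dvd_of_dvd_mul_left ⟨_, e3⟩
        refine ⟨s, hs', ?_⟩
        rw [hs'] at e3
        have e4 : (X - C a) * s = v - C c * ((X - C b) * u) := by
          apply mul_left_cancel₀ (pow_ne_zero j (X_sub_C_ne_zero b))
          rw [← e3]; ring
        have e5 : (b - a) * s.eval b = v.eval b := by
          simpa using congrArg (eval b) e4
        have : 0 ≤ (b - a) ^ 2 * (s.eval b * u.eval b) := by
          have : (b - a) ^ 2 * (s.eval b * u.eval b) = v.eval b * ((X - C a) * u).eval b := by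
            rw [← e5]; simp; ring
          rw [this]; exact hvb
        exact nonneg_of_mul_nonneg_right this (by positivity)
    · rw [e1] at hs
      exact splits_X_sub_C_mul_iff.mp hs

/-- For `l ≥ 2` the argument of `u ^ l` runs past `π` on the upper half plane, so the imaginary part
takes both signs. The angles `π / (2l)` and `3π / (2l)` witness this. -/
lemma sin_sign_of_pow_conj {s : ℝ} {l : ℕ} (hl : 2 ≤ l)
    (h : ∀ u : ℂ, 0 < u.im → ((starRingEnd ℂ) u ^ l).im * s ≤ 0) : s = 0 := by
  have hl0 : (0 : ℝ) < l := by positivity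
  have hl2 : (2 : ℝ) ≤ l := by exact_mod_cast hl
  have key : ∀ θ : ℝ, 0 < θ → θ < Real.pi → -Real.sin (l * θ) * s ≤ 0 := by
    intro θ h0 h1
    have := h (Complex.exp (θ * Complex.I)) (by
      rw [Complex.exp_ofReal_mul_I_im]; exact Real.sin_pos_of_pos_of_lt_pi h0 h1)
    have e : (starRingEnd ℂ) (Complex.exp (θ * Complex.I)) ^ l =
        Complex.exp ((-(l * θ) : ℝ) * Complex.I) := by
      rw [← Complex.exp_conj, ← Complex.exp_nat_mul]
      congr 1
      simp
      ring
    rwa [e, Complex.exp_ofReal_mul_I_im, Real.sin_neg] at this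
  have hpi := Real.pi_pos
  have h1 := key (Real.pi / 2 / l) (by positivity) (by rw [div_lt_iff₀ hl0]; nlinarith)
  have h2 := key ((Real.pi / 2 + Real.pi) / l) (by positivity) (by rw [div_lt_iff₀ hl0]; nlinarith)
  rw [mul_div_cancel₀ _ hl0.ne', Real.sin_pi_div_two] at h1
  rw [mul_div_cancel₀ _ hl0.ne', Real.sin_add_pi, Real.sin_pi_div_two] at h2
  linarith

/-- Put `z = a + r u`, divide by `r ^ (i + j) > 0` and let `r` tend to `0` from above. -/
lemma HalfPlaneNonpos.leading_term {a : ℝ} {i j : ℕ} {q p : ℝ[X]}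
    (h : HalfPlaneNonpos ((X - C a) ^ i * q) ((X - C a) ^ j * p)) {u : ℂ} (hu : 0 < u.im) :
    (u ^ i * (starRingEnd ℂ) u ^ j).im * (q.eval a * p.eval a) ≤ 0 := by
  set F : ℝ → ℝ := fun r => (u ^ i * (starRingEnd ℂ) u ^ j *
    (aeval ((a : ℂ) + r * u) q * (starRingEnd ℂ) (aeval ((a : ℂ) + r * u) p))).im with hF
  have hcont : Continuous F := by
    have h1 : ∀ w : ℝ[X], Continuous fun r : ℝ => aeval ((a : ℂ) + r * u) w := fun w =>
      w.continuous_aeval.comp (by fun_prop)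
    have h2 := h1 q
    have h3 := Complex.continuous_conj.comp (h1 p)
    exact Complex.continuous_im.comp (continuous_const.mul (h2.mul h3))
  have hpos : ∀ r : ℝ, 0 < r → F r ≤ 0 := by
    intro r hr
    have := h (a + r * u) (by simpa using mul_pos hr hu)
    simp only [map_mul, map_pow, map_sub, aeval_X, aeval_C] at this
    have e : (algebraMap ℝ ℂ) a = (a : ℂ) := rfl
    rw [e, map_add, map_mul, Complex.conj_ofReal, Complex.conj_ofReal, add_sub_cancel_left,
      add_sub_cancel_left] at this
    have e2 : (r * u) ^ i * aeval ((a : ℂ) + r * u) q *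
        ((r * (starRingEnd ℂ) u) ^ j * (starRingEnd ℂ) (aeval ((a : ℂ) + r * u) p)) =
        ((r ^ (i + j) : ℝ) : ℂ) * (u ^ i * (starRingEnd ℂ) u ^ j *
        (aeval ((a : ℂ) + r * u) q * (starRingEnd ℂ) (aeval ((a : ℂ) + r * u) p))) := by
      push_cast; ring
    rw [e2, Complex.im_ofReal_mul] at this
    exact nonpos_of_mul_nonpos_right this (by positivity)
  have hlim : F 0 ≤ 0 := by
    refine le_of_tendsto (f := F) (x := nhdsWithin 0 (Set.Ioi 0))
      (hcont.continuousWithinAt) ?_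
    filter_upwards [self_mem_nhdsWithin] with r hr using hpos r hr
  have e3 : ∀ w : ℝ[X], aeval (a : ℂ) w = ((w.eval a : ℝ) : ℂ) := fun w => by
    have := aeval_algebraMap_apply ℂ a w
    simpa using this
  simp only [hF, Complex.ofReal_zero, zero_mul, add_zero, e3, Complex.conj_ofReal] at hlim
  rwa [← Complex.ofReal_mul, Complex.im_mul_ofReal] at hlim

/-- A pole of `q / p` of order at least two would rotate the half plane through both signs, so poles
are simple; approaching one along `u = i` reads off the sign of its residue. -/
lemma HalfPlaneNonpos.residueNonneg {q p : ℝ[X]} (h : HalfPlaneNonpos q p) :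
    ResidueNonneg q p := by
  intro a k p₁ hp hpa
  by_cases hq : q = 0
  · exact ⟨0, by simp [hq], by simp⟩
  obtain ⟨j, q₁, hq₁, hqa⟩ := exists_pow_X_sub_C_mul hq a
  rw [hp, hq₁] at h
  have key := fun u hu => h.leading_term (u := u) hu
  rcases lt_trichotomy j k with hjk | rfl | hjk
  · exfalso
    obtain ⟨l, rfl⟩ := Nat.exists_eq_add_of_lt hjk
    refine mul_ne_zero hqa hpa (sin_sign_of_pow_conj (l := l + 2) (by omega) fun u hu => ?_)
    have := key u hu
    have e : u ^ j * (starRingEnd ℂ) u ^ (j + l + 1 + 1) =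
        ((Complex.normSq u ^ j : ℝ) : ℂ) * (starRingEnd ℂ) u ^ (l + 2) := by
      push_cast
      rw [← Complex.mul_conj]; ring
    rw [e, Complex.im_ofReal_mul, mul_assoc] at this
    refine nonpos_of_mul_nonpos_right this (pow_pos (Complex.normSq_pos.mpr ?_) _)
    rintro rfl
    simp at hu
  · refine ⟨q₁, hq₁, ?_⟩
    have := key Complex.I (by simp)
    have e : Complex.I ^ j * (starRingEnd ℂ) Complex.I ^ (j + 1) = -Complex.I := by
      rw [pow_succ, ← mul_assoc, ← mul_pow, Complex.mul_conj]; simp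
    rw [e] at this
    simp at this
    linarith
  · obtain ⟨l, rfl⟩ := Nat.exists_eq_add_of_lt hjk
    exact ⟨(X - C a) ^ (l + 1) * q₁, by rw [hq₁]; ring, by simp⟩

end Polynomial

/-! ### Interlacing root sequences and the residue condition -/

namespace Polynomial

/-- Fix a root `α j` and pair each `β i` with the root `α (j.succAbove i)`: `β i` lies between it
and `α j`. Pairs with both roots of `p` equal to `α j` force `β i = α j` and supply the order of
vanishing; in every other pair the two differences from `α j` do not have opposite signs. -/
lemma _root_.UnivInterlaces.residueNonneg {q p : ℝ[X]} (h : UnivInterlaces q p)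
    (hlq : 0 < q.leadingCoeff) (hlp : 0 < p.leadingCoeff) : ResidueNonneg q p := by
  classical
  obtain ⟨-, -, m, α, β, hα, -, hp, hq, hαβ⟩ := h
  intro a k p₁ hp₁ hpa
  obtain ⟨j, rfl⟩ : ∃ j, α j = a := by
    have h0 : p.eval a = 0 := by rw [hp₁]; simp
    rw [hp, eval_mul, eval_C, eval_prod, mul_eq_zero, Finset.prod_eq_zero_iff] at h0
    rcases h0 with h0 | ⟨j, -, hj⟩
    · exact absurd h0 hlp.ne'
    · exact ⟨j, by simp at hj; linarith⟩
  have hmid : ∀ i : Fin m, (α (j.succAbove i) ≤ β i ∧ β i ≤ α j) ∨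
      (α j ≤ β i ∧ β i ≤ α (j.succAbove i)) := by
    intro i
    by_cases hij : i.castSucc < j
    · rw [Fin.succAbove_of_castSucc_lt _ _ hij]
      exact .inl ⟨(hαβ i).1, (hαβ i).2.trans (hα (Fin.castSucc_lt_iff_succ_le.mp hij))⟩
    · rw [Fin.succAbove_of_le_castSucc _ _ (not_lt.mp hij)]
      exact .inr ⟨(hα (not_lt.mp hij)).trans (hαβ i).1, (hαβ i).2⟩
  set s : Finset (Fin m) := Finset.univ.filter fun i => α (j.succAbove i) = α j with hs
  have hβs : ∀ i ∈ s, β i = α j := by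
    intro i hi
    have hi' := (Finset.mem_filter.mp hi).2
    rcases hmid i with h | h <;> linarith [h.1, h.2]
  set u : ℝ[X] := C p.leadingCoeff * ∏ i ∈ Finset.univ.filter (fun i => ¬ α (j.succAbove i) = α j),
    (X - C (α (j.succAbove i))) with hu
  set v : ℝ[X] := C q.leadingCoeff * ∏ i ∈ Finset.univ.filter (fun i => ¬ α (j.succAbove i) = α j),
    (X - C (β i)) with hv
  have hqv : q = (X - C (α j)) ^ s.card * v := by
    conv_lhs => rw [hq, ← Finset.prod_filter_mul_prod_filter_not Finset.univ
      (fun i => α (j.succAbove i) = α j), ← hs]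
    rw [Finset.prod_congr rfl fun i hi => by rw [hβs i hi], Finset.prod_const, hv]
    ring
  have hpu : p = (X - C (α j)) ^ (s.card + 1) * u := by
    conv_lhs => rw [hp, Fin.prod_univ_succAbove _ j,
      ← Finset.prod_filter_mul_prod_filter_not Finset.univ
      (fun i => α (j.succAbove i) = α j), ← hs]
    rw [Finset.prod_congr rfl fun i hi => by rw [(Finset.mem_filter.mp hi).2], Finset.prod_const,
      hu]
    ring
  have hua : u.eval (α j) ≠ 0 := by
    rw [hu, eval_mul, eval_C, eval_prod]
    refine mul_ne_zero hlp.ne' (Finset.prod_ne_zero_iff.mpr fun i hi => ?_)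
    have := (Finset.mem_filter.mp hi).2
    simpa [sub_eq_zero] using fun h => this h.symm
  obtain ⟨hk, rfl⟩ := pow_X_sub_C_mul_unique (hp₁.symm.trans hpu) hpa hua
  obtain rfl : k = s.card := by omega
  refine ⟨v, hqv, ?_⟩
  rw [hu, hv, eval_mul, eval_C, eval_prod, eval_mul, eval_C, eval_prod, mul_mul_mul_comm,
    ← Finset.prod_mul_distrib]
  refine mul_nonneg (mul_pos hlq hlp).le (Finset.prod_nonneg fun i _ => ?_)
  simp only [eval_sub, eval_X, eval_C]
  rcases hmid i with h | h
  · exact mul_nonneg (by linarith [h.2]) (by linarith [h.1, h.2])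
  · exact mul_nonneg_of_nonpos_of_nonpos (by linarith [h.1]) (by linarith [h.1, h.2])

lemma le_of_lt_card_filter_le {n : ℕ} {α : Fin n → ℝ} (hα : Monotone α) {x : ℝ} {i : Fin n}
    (h : (i : ℕ) < (Finset.univ.filter fun j => α j ≤ x).card) : α i ≤ x := by
  by_contra! hx
  have : (Finset.univ.filter fun j => α j ≤ x) ⊆ Finset.Iio i := by
    intro j hj
    rw [Finset.mem_Iio]
    by_contra! hij
    exact absurd ((Finset.mem_filter.mp hj).2) (not_le.mpr (hx.trans_le (hα hij)))
  have := Finset.card_le_card this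
  rw [Fin.card_Iio] at this
  omega

lemma lt_card_filter_le {n : ℕ} {α : Fin n → ℝ} (hα : Monotone α) {x : ℝ} {i : Fin n}
    (h : α i ≤ x) : (i : ℕ) < (Finset.univ.filter fun j => α j ≤ x).card := by
  have : Finset.Iic i ⊆ (Finset.univ.filter fun j => α j ≤ x) := by
    intro j hj
    exact Finset.mem_filter.mpr ⟨Finset.mem_univ _, (hα (Finset.mem_Iic.mp hj)).trans h⟩
  have := Finset.card_le_card this
  rw [Fin.card_Iic] at this
  omega

/-- Interlacing of unordered lists of roots, expressed by counting roots in the rays `(-∞, x]`. -/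
def CountInterlaces (q p : ℝ[X]) : Prop :=
  ∃ (m : ℕ) (α : Fin (m + 1) → ℝ) (β : Fin m → ℝ),
    p = C p.leadingCoeff * ∏ i, (X - C (α i)) ∧ q = C q.leadingCoeff * ∏ i, (X - C (β i)) ∧
    ∀ x : ℝ, (Finset.univ.filter fun i => β i ≤ x).card ≤
        (Finset.univ.filter fun i => α i ≤ x).card ∧
      (Finset.univ.filter fun i => α i ≤ x).card ≤
        (Finset.univ.filter fun i => β i ≤ x).card + 1

lemma card_filter_comp_perm {n : ℕ} (σ : Equiv.Perm (Fin n)) (α : Fin n → ℝ) (x : ℝ) :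
    (Finset.univ.filter fun i => (α ∘ σ) i ≤ x).card =
      (Finset.univ.filter fun i => α i ≤ x).card := by
  refine Finset.card_bij (fun i _ => σ i) (fun i hi => by simpa using hi)
    (fun i _ j _ h => σ.injective h) fun j hj => ⟨σ.symm j, by simpa using hj, by simp⟩

lemma CountInterlaces.univInterlaces {q p : ℝ[X]} (h : CountInterlaces q p) (hq : q ≠ 0)
    (hp : p ≠ 0) : UnivInterlaces q p := by
  obtain ⟨m, α, β, hpα, hqβ, hc⟩ := h
  have hα := Tuple.monotone_sort α
  have hβ := Tuple.monotone_sort β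
  have hc' : ∀ x, _ := hc
  simp only [← card_filter_comp_perm (Tuple.sort α) α, ← card_filter_comp_perm (Tuple.sort β) β]
    at hc'
  refine ⟨hp, hq, m, α ∘ Tuple.sort α, β ∘ Tuple.sort β, hα, hβ, ?_, ?_, fun i => ⟨?_, ?_⟩⟩
  · simp only [Function.comp_apply]
    rw [Equiv.prod_comp (Tuple.sort α) fun i => X - C (α i)]; exact hpα
  · simp only [Function.comp_apply]
    rw [Equiv.prod_comp (Tuple.sort β) fun i => X - C (β i)]; exact hqβ
  · apply le_of_lt_card_filter_le hα
    have := lt_card_filter_le hβ (le_refl ((β ∘ Tuple.sort β) i))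
    exact this.trans_le (hc' _).1
  · apply le_of_lt_card_filter_le hβ
    have := lt_card_filter_le hα (le_refl ((α ∘ Tuple.sort α) i.succ))
    have h2 := (hc' ((α ∘ Tuple.sort α) i.succ)).2
    rw [Fin.val_succ] at this
    omega

/-- A common root raises both counts by the same amount, so no reordering is needed; this is the
reason for counting roots. -/
lemma CountInterlaces.X_sub_C_mul {q p : ℝ[X]} (h : CountInterlaces q p) (a : ℝ) :
    CountInterlaces ((X - C a) * q) ((X - C a) * p) := by
  obtain ⟨m, α, β, hpα, hqβ, hc⟩ := h
  refine ⟨m + 1, Fin.cons a α, Fin.cons a β, ?_, ?_, fun x => ?_⟩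
  · conv_lhs => rw [hpα]
    simp only [Fin.prod_univ_succ (n := m + 1), Fin.cons_zero, Fin.cons_succ, leadingCoeff_mul,
      leadingCoeff_X_sub_C, one_mul]
    ring
  · conv_lhs => rw [hqβ]
    simp only [Fin.prod_univ_succ (n := m), Fin.cons_zero, Fin.cons_succ, leadingCoeff_mul,
      leadingCoeff_X_sub_C, one_mul]
    ring
  · have := hc x
    rw [Fin.card_filter_univ_succ, Fin.card_filter_univ_succ]
    simp only [Fin.cons_zero, Fin.cons_succ]
    split_ifs <;> omega

lemma Splits.exists_monotone {p : ℝ[X]} (hs : p.Splits) {n : ℕ} (hn : p.natDegree = n) :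
    ∃ α : Fin n → ℝ, Monotone α ∧ p = C p.leadingCoeff * ∏ i, (X - C (α i)) := by
  have key : ∃ α : Fin n → ℝ, p = C p.leadingCoeff * ∏ i, (X - C (α i)) := by
    have hl : p.roots.toList.length = n := by
      rw [Multiset.length_toList, ← hs.natDegree_eq_card_roots, hn]
    subst hl
    refine ⟨p.roots.toList.get, ?_⟩
    conv_lhs => rw [hs.eq_prod_roots]
    congr 1
    rw [← Multiset.coe_toList p.roots, Multiset.map_coe, Multiset.prod_coe, ← List.prod_ofFn]
    congr 1
    conv_lhs => rw [← List.ofFn_get p.roots.toList, List.map_ofFn]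
    simp
  obtain ⟨α, h⟩ := key
  refine ⟨α ∘ Tuple.sort α, Tuple.monotone_sort α, ?_⟩
  simp only [Function.comp_apply]
  rw [Equiv.prod_comp (Tuple.sort α) fun i => X - C (α i)]
  exact h

/-- A multiple root of `p` would be a root of `q`, so the roots of `p` are simple. There `q` has the
sign of `p'`, which alternates; the intermediate value theorem gives one root of `q` in each of the
`m` gaps, and by degree these are all. -/
lemma ResidueNonneg.countInterlaces_of_no_common_root {q p : ℝ[X]} (h : ResidueNonneg q p)
    (hs : p.Splits) {m : ℕ} (hp : p.natDegree = m + 1) (hq : q.natDegree = m)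
    (hlp : 0 < p.leadingCoeff) (hno : ∀ a, p.eval a = 0 → q.eval a ≠ 0) :
    CountInterlaces q p := by
  obtain ⟨α, hα, hpα⟩ := hs.exists_monotone hp
  have hp0 : p ≠ 0 := leadingCoeff_ne_zero.mp hlp.ne'
  have hfac : ∀ j, p = (X - C (α j)) ^ (0 + 1) *
      (C p.leadingCoeff * ∏ i, (X - C (α (j.succAbove i)))) := by
    intro j
    conv_lhs => rw [hpα, Fin.prod_univ_succAbove _ j]
    ring
  have hpα0 : ∀ j, p.eval (α j) = 0 := fun j => by rw [hfac j]; simp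
  have hne : ∀ j, (C p.leadingCoeff * ∏ i, (X - C (α (j.succAbove i)))).eval (α j) ≠ 0 := by
    intro j
    obtain ⟨k, p₁, hk, hka⟩ := exists_pow_succ_X_sub_C_mul hp0 (hpα0 j)
    obtain ⟨q₁, hq₁, -⟩ := h _ _ _ hk hka
    cases k with
    | zero =>
      have := mul_left_cancel₀ (pow_ne_zero _ (X_sub_C_ne_zero (α j))) ((hfac j).symm.trans hk)
      rwa [this]
    | succ k => exact absurd (by rw [hq₁]; simp) (hno _ (hpα0 j))
  have hnej : ∀ j i, α j ≠ α (j.succAbove i) := by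
    intro j i hji
    apply hne j
    rw [eval_mul, eval_prod, Finset.prod_eq_zero (Finset.mem_univ i) (by simp [← hji]), mul_zero]
  have hsm : StrictMono α := hα.strictMono_of_injective fun j j' hjj => by
    by_contra hne'
    obtain ⟨i, rfl⟩ := Fin.exists_succAbove_eq (Ne.symm hne')
    exact hnej j i hjj
  have hpos : ∀ j, 0 < q.eval (α j) * ∏ i, (α j - α (j.succAbove i)) := by
    intro j
    obtain ⟨q₁, hq₁, hn⟩ := h _ _ _ (hfac j) (hne j)
    have e : q₁ = q := by simpa using hq₁.symm
    rw [e] at hn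
    have h1 := (mul_ne_zero (hno _ (hpα0 j)) (hne j)).symm.lt_of_le hn
    rw [eval_mul, eval_C, eval_prod, mul_left_comm] at h1
    simpa using (pos_iff_pos_of_mul_pos h1).mp hlp
  have hsign : ∀ k : Fin m, q.eval (α k.castSucc) * q.eval (α k.succ) < 0 := by
    intro k
    have h1 := mul_pos (hpos k.castSucc) (hpos k.succ)
    -- In the paired product for two consecutive roots only the factor `i = k`, comparing them with
    -- each other, is negative.
    rw [mul_mul_mul_comm, ← Finset.prod_mul_distrib,
      ← Finset.mul_prod_erase _ _ (Finset.mem_univ k)] at h1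
    rw [Fin.succAbove_castSucc_self, Fin.succAbove_succ_self] at h1
    have hk : α k.castSucc < α k.succ := hsm k.castSucc_lt_succ
    have h2 : (α k.castSucc - α k.succ) * (α k.succ - α k.castSucc) < 0 :=
      mul_neg_of_neg_of_pos (by linarith) (by linarith)
    have h3 : 0 < ∏ i ∈ Finset.univ.erase k, (α k.castSucc - α (k.castSucc.succAbove i)) *
        (α k.succ - α (k.succ.succAbove i)) := by
      refine Finset.prod_pos fun i hi => ?_
      rcases lt_or_gt_of_ne (Finset.ne_of_mem_erase hi) with hik | hik
      · rw [Fin.succAbove_of_castSucc_lt _ _ (by simpa using hik),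
          Fin.succAbove_of_castSucc_lt _ _ (by
            exact (Fin.castSucc_lt_castSucc_iff.mpr hik).trans k.castSucc_lt_succ)]
        have a1 : α i.castSucc < α k.castSucc := hsm (by simpa using hik)
        exact mul_pos (by linarith) (by linarith)
      · rw [Fin.succAbove_of_le_castSucc k.castSucc i (by simpa using hik.le),
          Fin.succAbove_of_le_castSucc k.succ i (by
            rw [Fin.succ_le_castSucc_iff]; exact hik)]
        have a1 : α k.succ < α i.succ := hsm (by simpa using hik)
        exact mul_pos_of_neg_of_neg (by linarith) (by linarith)
    by_contra! h4
    have := mul_nonpos_of_nonneg_of_nonpos h4 (mul_neg_of_neg_of_pos h2 h3).le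
    linarith
  have hroot : ∀ k : Fin m, ∃ b, α k.castSucc < b ∧ b < α k.succ ∧ q.eval b = 0 := by
    intro k
    have hk : α k.castSucc < α k.succ := hsm k.castSucc_lt_succ
    rcases mul_neg_iff.mp (hsign k) with ⟨h1, h2⟩ | ⟨h1, h2⟩
    · obtain ⟨b, hb, hb'⟩ := intermediate_value_Ioo' hk.le q.continuous.continuousOn ⟨h2, h1⟩
      exact ⟨b, hb.1, hb.2, hb'⟩
    · obtain ⟨b, hb, hb'⟩ := intermediate_value_Ioo hk.le q.continuous.continuousOn ⟨h1, h2⟩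
      exact ⟨b, hb.1, hb.2, hb'⟩
  choose β hβ1 hβ2 hβ0 using hroot
  have hβinj : Function.Injective β := by
    refine StrictMono.injective fun i j hij => ?_
    have : α i.succ ≤ α j.castSucc := hα (by rw [Fin.succ_le_castSucc_iff]; exact hij)
    linarith [hβ2 i, hβ1 j]
  refine ⟨m, α, β, hpα, ?_, fun x => ⟨?_, ?_⟩⟩
  · have hdvd : ∏ i, (X - C (β i)) ∣ q := by
      refine Finset.prod_dvd_of_coprime (fun i _ j _ hij => ?_)
        fun i _ => dvd_iff_isRoot.mpr (hβ0 i)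
      exact isCoprime_X_sub_C_of_isUnit_sub (sub_ne_zero.mpr (hβinj.ne hij)).isUnit
    have hmon : (∏ i, (X - C (β i))).Monic := monic_prod_of_monic _ _ fun i _ => monic_X_sub_C _
    have := eq_leadingCoeff_mul_of_monic_of_dvd_of_natDegree_le hmon hdvd (by
      rw [hq, natDegree_prod_of_monic _ _ fun i _ => monic_X_sub_C _]; simp)
    exact this
  · refine Finset.card_le_card_of_injOn Fin.castSucc (fun i hi => ?_)
      (Fin.castSucc_injective m).injOn
    simp only [Finset.coe_filter, Finset.mem_univ, true_and, Set.mem_ofPred_eq] at hi ⊢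
    linarith [hβ1 i]
  · rw [Fin.card_filter_univ_succ]
    have : (Finset.univ.filter fun i => ((fun i => α i ≤ x) ∘ Fin.succ) i).card ≤
        (Finset.univ.filter fun i => β i ≤ x).card := by
      refine Finset.card_le_card fun i hi => ?_
      simp only [Finset.mem_filter, Finset.mem_univ, true_and, Function.comp] at hi ⊢
      linarith [hβ2 i]
    simp only [Function.comp_def] at this
    split_ifs <;> omega

lemma ResidueNonneg.of_X_sub_C_mul {q p : ℝ[X]} {c : ℝ}
    (h : ResidueNonneg ((X - C c) * q) ((X - C c) * p)) : ResidueNonneg q p := by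
  intro a k p₁ hp ha
  by_cases hac : a = c
  · subst hac
    obtain ⟨q₁, hq, hn⟩ := h a (k + 1) p₁ (by rw [hp]; ring) ha
    refine ⟨q₁, mul_left_cancel₀ (X_sub_C_ne_zero a) ?_, hn⟩
    rw [hq]; ring
  · obtain ⟨q₁, hq, hn⟩ := h a k ((X - C c) * p₁) (by rw [hp]; ring)
      (by simpa using ⟨sub_ne_zero.mpr hac, ha⟩)
    obtain ⟨s, hs⟩ := (coprime_pow_X_sub_C hac k).symm.dvd_of_dvd_mul_left ⟨q, hq.symm⟩
    refine ⟨s, mul_left_cancel₀ (X_sub_C_ne_zero c) ?_, ?_⟩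
    · rw [hq, hs]; ring
    · rw [hs] at hn
      have e : ((X - C c) * s).eval a * ((X - C c) * p₁).eval a =
        (a - c) ^ 2 * (s.eval a * p₁.eval a) := by simp; ring
      rw [e] at hn
      have : a - c ≠ 0 := sub_ne_zero.mpr hac
      exact nonneg_of_mul_nonneg_right hn (by positivity)

/-- Common roots are divided out until none is left, then put back. -/
lemma ResidueNonneg.countInterlaces {q p : ℝ[X]} (h : ResidueNonneg q p)
    (hs : p.Splits) {m : ℕ} (hp : p.natDegree = m + 1) (hq : q.natDegree = m)
    (hlp : 0 < p.leadingCoeff) (hlq : 0 < q.leadingCoeff) : CountInterlaces q p := by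
  induction m using Nat.strong_induction_on generalizing q p with | _ m ih
  by_cases hno : ∀ a, p.eval a = 0 → q.eval a ≠ 0
  · exact h.countInterlaces_of_no_common_root hs hp hq hlp hno
  · push Not at hno
    obtain ⟨a, hpa, hqa⟩ := hno
    obtain ⟨p₀, rfl⟩ := exists_X_sub_C_mul_of_eval_eq_zero hpa
    obtain ⟨q₀, rfl⟩ := exists_X_sub_C_mul_of_eval_eq_zero hqa
    rw [leadingCoeff_mul, leadingCoeff_X_sub_C, one_mul] at hlp hlq
    rw [natDegree_mul (X_sub_C_ne_zero a) (leadingCoeff_ne_zero.mp hlp.ne'),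
      natDegree_X_sub_C] at hp
    rw [natDegree_mul (X_sub_C_ne_zero a) (leadingCoeff_ne_zero.mp hlq.ne'),
      natDegree_X_sub_C] at hq
    cases m with
    | zero => omega
    | succ m =>
      exact (ih m m.lt_succ_self h.of_X_sub_C_mul (splits_X_sub_C_mul_iff.mp hs) (by omega)
        (by omega) hlp hlq).X_sub_C_mul a

/-- For polynomials of degrees `m + 1` and `m` with positive leading coefficients, the first of
them with only real roots, interlacing is the half plane condition. -/
lemma univInterlaces_iff_halfPlaneNonpos {q p : ℝ[X]} {m : ℕ} (hs : p.Splits)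
    (hp : p.natDegree = m + 1) (hq : q.natDegree = m) (hlp : 0 < p.leadingCoeff)
    (hlq : 0 < q.leadingCoeff) : UnivInterlaces q p ↔ HalfPlaneNonpos q p := by
  have hp0 := leadingCoeff_ne_zero.mp hlp.ne'
  have hq0 := leadingCoeff_ne_zero.mp hlq.ne'
  refine ⟨fun h => ((h.residueNonneg hlq hlp).quotientComb hs ?_).halfPlaneNonpos, fun h =>
    (h.residueNonneg.countInterlaces hs hp hq hlp hlq).univInterlaces hq0 hp0⟩
  rw [degree_eq_natDegree hp0, degree_eq_natDegree hq0, hp, hq]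
  exact_mod_cast m.lt_succ_self

end Polynomial

/-! ### Degree and top coefficient of a form along a line -/

section LinearSubstitution

variable {n : ℕ} {A : Type*} [CommRing A]

lemma natDegree_prod_linear_pow_le (u v : Fin n → A) (m : Fin n →₀ ℕ) (s : Finset (Fin n)) :
    (∏ i ∈ s, (Polynomial.X * Polynomial.C (u i) + Polynomial.C (v i)) ^ m i).natDegree ≤
        ∑ i ∈ s, m i ∧
      (∏ i ∈ s, (Polynomial.X * Polynomial.C (u i) + Polynomial.C (v i)) ^ m i).coeff
        (∑ i ∈ s, m i) = ∏ i ∈ s, u i ^ m i := by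
  classical
  have h1 : ∀ i, (Polynomial.X * Polynomial.C (u i) + Polynomial.C (v i)).natDegree ≤ 1 :=
    fun i => by rw [Polynomial.X_mul_C]; exact Polynomial.natDegree_linear_le
  have h2 : ∀ i, ((Polynomial.X * Polynomial.C (u i) + Polynomial.C (v i)) ^ m i).natDegree ≤
      m i := fun i => by simpa using Polynomial.natDegree_pow_le_of_le (m i) (h1 i)
  induction s using Finset.induction_on with
  | empty => simp
  | insert i s hi ih =>
    rw [Finset.prod_insert hi, Finset.sum_insert hi, Finset.prod_insert hi]
    refine ⟨Polynomial.natDegree_mul_le_of_le (h2 i) ih.1, ?_⟩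
    rw [Polynomial.coeff_mul_add_eq_of_natDegree_le (h2 i) ih.1, ih.2]
    congr 1
    have := Polynomial.coeff_pow_of_natDegree_le (m := m i) (h1 i)
    rw [mul_one] at this
    rw [this]
    simp [Polynomial.coeff_C]

lemma MvPolynomial.IsHomogeneous.sum_exponents {f : MvPolynomial (Fin n) ℝ} {d : ℕ}
    (hf : f.IsHomogeneous d) {m : Fin n →₀ ℕ} (hm : m ∈ f.support) : ∑ i, m i = d := by
  rw [hf.degree_eq_sum_deg_support hm, ← Finsupp.degree_apply, Finsupp.degree_eq_sum]

/-- The ring `A` is kept general to serve both real lines and the generic line, whose base point has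
the variables as coordinates. -/
lemma MvPolynomial.IsHomogeneous.linear_substitution [Algebra ℝ A] {f : MvPolynomial (Fin n) ℝ} {d : ℕ}
    (hf : f.IsHomogeneous d) (u v : Fin n → A) :
    (MvPolynomial.aeval (fun i => Polynomial.X * Polynomial.C (u i) + Polynomial.C (v i)) f).natDegree ≤ d ∧
      (MvPolynomial.aeval (fun i => Polynomial.X * Polynomial.C (u i) + Polynomial.C (v i)) f).coeff d =
        MvPolynomial.aeval u f := by
  have hd : ∀ m ∈ f.support, ∑ i, m i = d := fun m hm => hf.sum_exponents hm
  rw [MvPolynomial.aeval_def, eval₂_eq', MvPolynomial.aeval_def, eval₂_eq']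
  constructor
  · refine Polynomial.natDegree_sum_le_of_forall_le _ _ fun m hm => ?_
    rw [IsScalarTower.algebraMap_apply ℝ A, ← hd m hm]
    exact (Polynomial.natDegree_C_mul_le _ _).trans (natDegree_prod_linear_pow_le u v m _).1
  · rw [Polynomial.finsetSum_coeff]
    refine Finset.sum_congr rfl fun m hm => ?_
    have : (algebraMap ℝ (Polynomial A)) (coeff m f) =
      Polynomial.C (algebraMap ℝ A (coeff m f)) := IsScalarTower.algebraMap_apply ℝ A _ _
    rw [this, Polynomial.coeff_C_mul, ← hd m hm, (natDegree_prod_linear_pow_le u v m _).2]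

end LinearSubstitution

/-! ### Factors of a form are forms -/

section Homogeneous

variable {n : ℕ}

/-- The polynomial `f(s x)` in the variable `s`. -/
noncomputable def scaleHom (n : ℕ) :
    MvPolynomial (Fin n) ℝ →ₐ[ℝ] Polynomial (MvPolynomial (Fin n) ℝ) :=
  aeval fun i => Polynomial.X * Polynomial.C (X i)

lemma scaleHom_monomial (m : Fin n →₀ ℕ) (c : ℝ) :
    scaleHom n (monomial m c) = Polynomial.monomial m.degree (monomial m c) := by
  rw [scaleHom, aeval_monomial, Finsupp.prod_fintype _ _ (by simp)]
  simp_rw [mul_pow]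
  rw [Finset.prod_mul_distrib, Finset.prod_pow_eq_pow_sum, ← Finsupp.degree_eq_sum,
    IsScalarTower.algebraMap_apply ℝ (MvPolynomial (Fin n) ℝ), Polynomial.algebraMap_eq,
    ← Polynomial.C_mul_X_pow_eq_monomial, monomial_eq, Finsupp.prod_fintype _ _ (by simp)]
  simp only [map_mul, map_prod, map_pow, MvPolynomial.algebraMap_eq]
  ring

lemma coeff_scaleHom (f : MvPolynomial (Fin n) ℝ) (k : ℕ) :
    (scaleHom n f).coeff k = homogeneousComponent k f := by
  induction f using MvPolynomial.induction_on' with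
  | monomial m c =>
    rw [scaleHom_monomial, Polynomial.coeff_monomial]
    ext m'
    rw [coeff_homogeneousComponent]
    split_ifs with h1 h2 h2
    · rfl
    · rw [coeff_monomial, if_neg]
      rintro rfl
      exact h2 h1
    · rw [coeff_monomial, if_neg, coeff_zero]
      rintro rfl
      exact h1 h2
    · simp
  | add p q hp hq => rw [map_add, Polynomial.coeff_add, hp, hq, map_add]

lemma scaleHom_eq_iff {f : MvPolynomial (Fin n) ℝ} {d : ℕ} :
    scaleHom n f = Polynomial.monomial d f ↔ f.IsHomogeneous d := by
  constructor
  · intro h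
    have := congrArg (fun p => p.coeff d) h
    simp only [coeff_scaleHom, Polynomial.coeff_monomial, if_true] at this
    rw [← this]
    exact homogeneousComponent_isHomogeneous d f
  · intro h
    ext1 k
    rw [coeff_scaleHom, Polynomial.coeff_monomial, homogeneousComponent_of_mem h]
    simp only [eq_comm]

lemma scaleHom_injective : Function.Injective (scaleHom n) := by
  intro f g h
  rw [← sum_homogeneousComponent f, ← sum_homogeneousComponent g]
  have e : ∀ k, homogeneousComponent k f = homogeneousComponent k g := fun k => by
    rw [← coeff_scaleHom, ← coeff_scaleHom, h]
  have key : ∀ (p : MvPolynomial (Fin n) ℝ) (N : ℕ), p.totalDegree ≤ N →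
      ∑ i ∈ Finset.range (p.totalDegree + 1), homogeneousComponent i p =
      ∑ i ∈ Finset.range (N + 1), homogeneousComponent i p := by
    intro p N hN
    refine Finset.sum_subset (Finset.range_mono (by omega)) fun i _ hi => ?_
    exact homogeneousComponent_eq_zero _ _ (by simpa [Nat.lt_succ_iff] using hi)
  rw [key f _ (le_max_left f.totalDegree g.totalDegree),
    key g _ (le_max_right f.totalDegree g.totalDegree)]
  exact Finset.sum_congr rfl fun i _ => e i

/-- In the scaling variable the product is a monomial. Top and lowest degrees both add over a
domain, so they must agree in each factor. -/
lemma MvPolynomial.IsHomogeneous.of_mul_left {f g : MvPolynomial (Fin n) ℝ} {d : ℕ}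
    (h : (f * g).IsHomogeneous d) (h0 : f * g ≠ 0) : ∃ k, f.IsHomogeneous k := by
  have hf : scaleHom n f ≠ 0 := fun h' => left_ne_zero_of_mul h0
    (scaleHom_injective (h'.trans (map_zero _).symm))
  have hg : scaleHom n g ≠ 0 := fun h' => right_ne_zero_of_mul h0
    (scaleHom_injective (h'.trans (map_zero _).symm))
  have e := scaleHom_eq_iff.mpr h
  rw [map_mul] at e
  have e1 := congrArg Polynomial.natDegree e
  have e2 := congrArg Polynomial.natTrailingDegree e
  rw [Polynomial.natDegree_mul hf hg, Polynomial.natDegree_monomial_eq _ h0] at e1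
  rw [Polynomial.natTrailingDegree_mul hf hg, Polynomial.natTrailingDegree_monomial h0] at e2
  have l1 := (scaleHom n f).natTrailingDegree_le_natDegree
  have l2 := (scaleHom n g).natTrailingDegree_le_natDegree
  set k := (scaleHom n f).natDegree
  have hk : ∀ i, i ≠ k → homogeneousComponent i f = 0 := by
    intro i hi
    rw [← coeff_scaleHom]
    rcases lt_or_gt_of_ne hi with hi | hi
    · exact Polynomial.coeff_eq_zero_of_lt_natTrailingDegree (by omega)
    · exact Polynomial.coeff_eq_zero_of_natDegree_lt hi
  refine ⟨k, ?_⟩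
  rw [← sum_homogeneousComponent f]
  refine IsHomogeneous.sum _ _ _ fun i _ => ?_
  by_cases hi : i = k
  · exact hi ▸ homogeneousComponent_isHomogeneous i f
  · rw [hk i hi]; exact isHomogeneous_zero _ _ _

lemma MvPolynomial.IsHomogeneous.of_mul {f g : MvPolynomial (Fin n) ℝ} {d : ℕ}
    (h : (f * g).IsHomogeneous d) (h0 : f * g ≠ 0) :
    ∃ k l, f.IsHomogeneous k ∧ g.IsHomogeneous l ∧ k + l = d := by
  obtain ⟨k, hk⟩ := h.of_mul_left h0
  obtain ⟨l, hl⟩ := IsHomogeneous.of_mul_left (f := g) (g := f) (mul_comm f g ▸ h)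
    (mul_comm f g ▸ h0)
  exact ⟨k, l, hk, hl, (hk.mul hl).inj_right h h0⟩

end Homogeneous

/-! ### Restriction to lines and to the generic line -/

section Restriction

variable {n : ℕ}

lemma eval_restrictToLine (f : MvPolynomial (Fin n) ℝ) (e a : Fin n → ℝ) (t : ℝ) :
    (restrictToLine f e a).eval t = eval (fun i => t * e i + a i) f := by
  rw [restrictToLine, ← Polynomial.coe_evalRingHom, aeval_def, hom_eval₂, eval, coe_eval₂Hom]
  congr 1
  · ext; simp
  · ext
    simp
    ring

lemma aeval_restrictToLine (f : MvPolynomial (Fin n) ℝ) (e a : Fin n → ℝ) (z : ℂ) :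
    Polynomial.aeval z (restrictToLine f e a) = aeval (fun i => z * e i + a i) f := by
  rw [restrictToLine, ← AlgHom.comp_apply, comp_aeval]
  congr 2
  ext i
  simp
  ring

lemma restrictToLine_mul (f g : MvPolynomial (Fin n) ℝ) (e a : Fin n → ℝ) :
    restrictToLine (f * g) e a = restrictToLine f e a * restrictToLine g e a :=
  map_mul _ _ _

lemma restrictToLine_dirDeriv (f : MvPolynomial (Fin n) ℝ) (e a : Fin n → ℝ) :
    restrictToLine (dirDeriv e f) e a = Polynomial.derivative (restrictToLine f e a) := by
  simp only [restrictToLine, dirDeriv]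
  induction f using MvPolynomial.induction_on with
  | C c =>
    simp only [pderiv_C, smul_zero, Finset.sum_const_zero, map_zero, MvPolynomial.algHom_C]
    exact (Polynomial.derivative_C (a := c)).symm
  | add p q hp hq =>
    rw [map_add, Polynomial.derivative_add, ← hp, ← hq, ← map_add, ← Finset.sum_add_distrib]
    simp
  | mul_X p j hp =>
    rw [map_mul, Polynomial.derivative_mul, ← hp]
    have : ∑ i, e i • pderiv i (p * X j) = (∑ i, e i • pderiv i p) * X j + p * C (e j) := by
      simp only [pderiv_mul, pderiv_X, smul_add, Finset.sum_add_distrib, Finset.sum_mul]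
      congr 1
      · exact Finset.sum_congr rfl fun i _ => by rw [smul_mul_assoc]
      · rw [Finset.sum_eq_single j]
        · simp [smul_eq_C_mul, mul_comm]
        · intro i _ hij; simp [hij.symm]
        · simp
    rw [this, map_add, map_mul, map_mul]
    simp [Polynomial.derivative_mul, MvPolynomial.algHom_C]

lemma MvPolynomial.IsHomogeneous.natDegree_restrictToLine_le {f : MvPolynomial (Fin n) ℝ} {d : ℕ}
    (hf : f.IsHomogeneous d) (e a : Fin n → ℝ) : (restrictToLine f e a).natDegree ≤ d :=
  (hf.linear_substitution e a).1

lemma MvPolynomial.IsHomogeneous.coeff_restrictToLine {f : MvPolynomial (Fin n) ℝ} {d : ℕ}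
    (hf : f.IsHomogeneous d) (e a : Fin n → ℝ) : (restrictToLine f e a).coeff d = eval e f :=
  (hf.linear_substitution e a).2

lemma MvPolynomial.IsHomogeneous.natDegree_restrictToLine {f : MvPolynomial (Fin n) ℝ} {d : ℕ}
    (hf : f.IsHomogeneous d) {e : Fin n → ℝ} (he : eval e f ≠ 0) (a : Fin n → ℝ) :
    (restrictToLine f e a).natDegree = d :=
  Polynomial.natDegree_eq_of_le_of_coeff_ne_zero (hf.natDegree_restrictToLine_le e a)
    (by rwa [hf.coeff_restrictToLine])

lemma MvPolynomial.IsHomogeneous.leadingCoeff_restrictToLine {f : MvPolynomial (Fin n) ℝ} {d : ℕ}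
    (hf : f.IsHomogeneous d) {e : Fin n → ℝ} (he : eval e f ≠ 0) (a : Fin n → ℝ) :
    (restrictToLine f e a).leadingCoeff = eval e f := by
  rw [Polynomial.leadingCoeff, hf.natDegree_restrictToLine he, hf.coeff_restrictToLine]

lemma MvPolynomial.IsHomogeneous.restrictToLine_ne_zero {f : MvPolynomial (Fin n) ℝ} {d : ℕ}
    (hf : f.IsHomogeneous d) {e : Fin n → ℝ} (he : eval e f ≠ 0) (a : Fin n → ℝ) :
    restrictToLine f e a ≠ 0 := fun h => he (by rw [← hf.coeff_restrictToLine e a, h]; simp)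

lemma MvPolynomial.IsHomogeneous.restrictToLine_zero {f : MvPolynomial (Fin n) ℝ} {d : ℕ}
    (hf : f.IsHomogeneous d) (e : Fin n → ℝ) :
    restrictToLine f e 0 = Polynomial.C (eval e f) * Polynomial.X ^ d := by
  refine Polynomial.funext fun t => ?_
  rw [eval_restrictToLine, eval_eq', Polynomial.eval_mul, Polynomial.eval_C, Polynomial.eval_pow,
    Polynomial.eval_X, eval_eq', Finset.sum_mul]
  refine Finset.sum_congr rfl fun m hm => ?_
  simp only [Pi.zero_apply, add_zero, mul_pow]
  rw [Finset.prod_mul_distrib, Finset.prod_pow_eq_pow_sum, hf.sum_exponents hm]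
  ring

/-- The restriction of `f` to the line in direction `e` through the generic point. -/
noncomputable def genericRestriction (e : Fin n → ℝ) (f : MvPolynomial (Fin n) ℝ) :
    Polynomial (MvPolynomial (Fin n) ℝ) :=
  aeval (fun i => Polynomial.X * Polynomial.C (C (e i)) + Polynomial.C (X i)) f

lemma map_genericRestriction (e : Fin n → ℝ) (f : MvPolynomial (Fin n) ℝ) (a : Fin n → ℝ) :
    (genericRestriction e f).map (eval a) = restrictToLine f e a := by
  rw [genericRestriction, ← Polynomial.coe_mapRingHom, restrictToLine, aeval_def, hom_eval₂,
    aeval_def]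
  congr 1
  · ext r; simp [MvPolynomial.algebraMap_eq, IsScalarTower.algebraMap_apply ℝ
      (MvPolynomial (Fin n) ℝ) (Polynomial (MvPolynomial (Fin n) ℝ))]
  · ext1 i; simp

lemma eval_zero_genericRestriction (e : Fin n → ℝ) (f : MvPolynomial (Fin n) ℝ) :
    (genericRestriction e f).eval 0 = f := by
  rw [genericRestriction, ← Polynomial.coe_evalRingHom, aeval_def, hom_eval₂]
  conv_rhs => rw [← eval₂_eta f]
  congr 1
  · ext r; simp [MvPolynomial.algebraMap_eq, IsScalarTower.algebraMap_apply ℝ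
      (MvPolynomial (Fin n) ℝ) (Polynomial (MvPolynomial (Fin n) ℝ))]
  · ext1 i; simp

/-- The restriction to the generic line, normalized to be monic. -/
noncomputable def monicRestriction (e : Fin n → ℝ) (f : MvPolynomial (Fin n) ℝ) :
    Polynomial (MvPolynomial (Fin n) ℝ) :=
  Polynomial.C (C (eval e f)⁻¹) * genericRestriction e f

lemma monicRestriction_monic {f : MvPolynomial (Fin n) ℝ} {d : ℕ} (hf : f.IsHomogeneous d)
    {e : Fin n → ℝ} (he : eval e f ≠ 0) : (monicRestriction e f).Monic := by
  have h := hf.linear_substitution (fun i => (C (e i) : MvPolynomial (Fin n) ℝ)) X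
  refine Polynomial.monic_of_natDegree_le_of_coeff_eq_one d
    ((Polynomial.natDegree_C_mul_le _ _).trans h.1) ?_
  have e1 : aeval (fun i => (C (e i) : MvPolynomial (Fin n) ℝ)) f = C (eval e f) := by
    have := aeval_algebraMap_apply (MvPolynomial (Fin n) ℝ) e f
    simpa [MvPolynomial.algebraMap_eq, Function.comp_def] using this
  rw [monicRestriction, Polynomial.coeff_C_mul, genericRestriction, h.2, e1, ← C_mul,
    inv_mul_cancel₀ he, C_1]

lemma map_monicRestriction (e : Fin n → ℝ) (f : MvPolynomial (Fin n) ℝ) (a : Fin n → ℝ) :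
    (monicRestriction e f).map (eval a) =
      Polynomial.C (eval e f)⁻¹ * restrictToLine f e a := by
  rw [monicRestriction, Polynomial.map_mul, map_genericRestriction, Polynomial.map_C, eval_C]

/-- Gauss's lemma: over an integrally closed domain a factor of a monic polynomial over the fraction
field is, up to a scalar, monic over the domain. -/
lemma Polynomial.Monic.squarefree_map_of_forall {A : Type*} (K : Type*) [CommRing A]
    [IsDomain A] [IsIntegrallyClosed A] [Field K] [Algebra A K] [IsFractionRing A K]
    {P : Polynomial A} (hP : P.Monic) (h : ∀ H : Polynomial A, H.Monic → H * H ∣ P → H = 1) :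
    Squarefree (P.map (algebraMap A K)) := by
  intro G hG
  have hG0 : G ≠ 0 := fun h => (hP.map (algebraMap A K)).ne_zero (by simpa [h] using hG)
  obtain ⟨H, hH⟩ := IsIntegrallyClosed.eq_map_mul_C_of_dvd K hP ((dvd_mul_left G G).trans hG)
  have hHm : H.Monic := by
    apply Polynomial.monic_of_injective (IsFractionRing.injective A K)
    have := congrArg Polynomial.leadingCoeff hH
    rw [Polynomial.leadingCoeff_mul, Polynomial.leadingCoeff_C] at this
    exact mul_right_cancel₀ (Polynomial.leadingCoeff_ne_zero.mpr hG0) (this.trans (one_mul _).symm)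
  have hH1 : H = 1 := by
    refine h H hHm (hP.dvd_of_fraction_map_dvd_fraction_map (K := K) (hHm.mul hHm) ?_)
    refine dvd_trans ?_ hG
    rw [Polynomial.map_mul]
    have : H.map (algebraMap A K) ∣ G := ⟨_, hH.symm⟩
    exact mul_dvd_mul this this
  rw [← hH, hH1, Polynomial.map_one, one_mul]
  exact (Polynomial.leadingCoeff_ne_zero.mpr hG0).isUnit.map Polynomial.C

/-- Square-free means separable in characteristic zero; clearing denominators in the Bézout identity
yields `r`, which plays the role of a discriminant. -/
lemma Polynomial.exists_bezout_derivative {A : Type*} (K : Type*) [CommRing A] [IsDomain A]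
    [Field K] [CharZero K] [Algebra A K] [IsFractionRing A K] {P : Polynomial A}
    (h : Squarefree (P.map (algebraMap A K))) :
    ∃ (r : A) (U V : Polynomial A), r ≠ 0 ∧
      U * P + V * Polynomial.derivative P = Polynomial.C r := by
  obtain ⟨u, v, huv⟩ := PerfectField.separable_iff_squarefree.mpr h
  obtain ⟨b, hb, hbu⟩ := IsLocalization.integerNormalization_spec (nonZeroDivisors A) u
  obtain ⟨c, hc, hcv⟩ := IsLocalization.integerNormalization_spec (nonZeroDivisors A) v
  refine ⟨b * c, Polynomial.C c * IsLocalization.integerNormalization (nonZeroDivisors A) u,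
    Polynomial.C b * IsLocalization.integerNormalization (nonZeroDivisors A) v,
    mul_ne_zero (nonZeroDivisors.ne_zero hb) (nonZeroDivisors.ne_zero hc), ?_⟩
  apply Polynomial.map_injective _ (IsFractionRing.injective A K)
  have e1 : ∀ (x : A) (w : Polynomial K), x • w = Polynomial.C (algebraMap A K x) * w :=
    fun x w => by rw [← Polynomial.smul_eq_C_mul, algebraMap_smul]
  simp only [Polynomial.map_add, Polynomial.map_mul, Polynomial.map_C, hbu, hcv,
    ← Polynomial.derivative_map, e1, map_mul]
  linear_combination Polynomial.C (algebraMap A K b) * Polynomial.C (algebraMap A K c) * huv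

/-- At `t = 0` the square of `H` divides `f` up to a unit, so `H(0)` is a nonzero constant. At `x =
0` the monic `H` divides `t ^ d`, so it is a power of `t`; as it does not vanish at `t = 0`, its
degree is zero. -/
lemma eq_one_of_mul_self_dvd_monicRestriction {f : MvPolynomial (Fin n) ℝ} {d : ℕ}
    (hf : f.IsHomogeneous d) {e : Fin n → ℝ} (he : eval e f ≠ 0) (hsq : Squarefree f)
    {H : Polynomial (MvPolynomial (Fin n) ℝ)} (hHm : H.Monic)
    (hHH : H * H ∣ monicRestriction e f) : H = 1 := by
  have hu : IsUnit (H.eval 0) := by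
    apply hsq
    have := map_dvd (Polynomial.evalRingHom (0 : MvPolynomial (Fin n) ℝ)) hHH
    rw [map_mul, monicRestriction, map_mul, Polynomial.coe_evalRingHom,
      eval_zero_genericRestriction, Polynomial.eval_C] at this
    have hc : IsUnit (C (eval e f)⁻¹ : MvPolynomial (Fin n) ℝ) := (inv_ne_zero he).isUnit.map C
    exact (hc.dvd_mul_left).mp this
  have hX : H.map (eval (0 : Fin n → ℝ)) ∣ Polynomial.X ^ d := by
    have h2 := Polynomial.map_dvd (eval (0 : Fin n → ℝ)) ((dvd_mul_left H H).trans hHH)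
    rwa [map_monicRestriction, hf.restrictToLine_zero, ← mul_assoc, ← Polynomial.C_mul,
      inv_mul_cancel₀ he, Polynomial.C_1, one_mul] at h2
  obtain ⟨i, -, hi⟩ := (dvd_prime_pow Polynomial.prime_X d).mp hX
  have hi' := Polynomial.eq_of_monic_of_associated (hHm.map _) (Polynomial.monic_X_pow i) hi
  have hi0 : i = 0 := by
    by_contra hi0
    have h3 : (H.map (eval (0 : Fin n → ℝ))).eval 0 = 0 := by
      rw [hi', Polynomial.eval_pow, Polynomial.eval_X, zero_pow hi0]
    rw [Polynomial.eval_zero_map] at h3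
    exact (hu.map (eval (0 : Fin n → ℝ))).ne_zero h3
  refine Polynomial.eq_one_of_monic_natDegree_zero hHm ?_
  rw [← hHm.natDegree_map (eval (0 : Fin n → ℝ)), hi', hi0]
  simp

/-- A square-free form restricts to polynomials without multiple zeros on generic lines. -/
lemma exists_generic_isCoprime_derivative {f : MvPolynomial (Fin n) ℝ} {d : ℕ}
    (hf : f.IsHomogeneous d) {e : Fin n → ℝ} (he : eval e f ≠ 0) (hsq : Squarefree f) :
    ∃ r : MvPolynomial (Fin n) ℝ, r ≠ 0 ∧ ∀ a, eval a r ≠ 0 →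
      IsCoprime (restrictToLine f e a) (Polynomial.derivative (restrictToLine f e a)) := by
  obtain ⟨r, U, V, hr, hid⟩ := Polynomial.exists_bezout_derivative
    (FractionRing (MvPolynomial (Fin n) ℝ))
    ((monicRestriction_monic hf he).squarefree_map_of_forall _
      fun H hH hHH => eq_one_of_mul_self_dvd_monicRestriction hf he hsq hH hHH)
  refine ⟨r, hr, fun a ha => ?_⟩
  have h := congrArg (Polynomial.map (eval a)) hid
  simp only [Polynomial.map_add, Polynomial.map_mul, Polynomial.map_C,
      ← Polynomial.derivative_map, map_monicRestriction, Polynomial.derivative_C_mul] at h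
  set k := (eval e f)⁻¹
  set w := eval a r
  refine ⟨Polynomial.C w⁻¹ * (U.map (eval a) * Polynomial.C k),
    Polynomial.C w⁻¹ * (V.map (eval a) * Polynomial.C k), ?_⟩
  have h1 : Polynomial.C w⁻¹ * Polynomial.C w = 1 := by
    rw [← Polynomial.C_mul, inv_mul_cancel₀ ha, Polynomial.C_1]
  linear_combination Polynomial.C w⁻¹ * h + h1

/-- On the line from `a` to a point where `r` is nonzero, `r` has finitely many zeros. -/
lemma dense_eval_ne_zero {r : MvPolynomial (Fin n) ℝ} (hr : r ≠ 0) :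
    Dense {a : Fin n → ℝ | eval a r ≠ 0} := by
  intro a
  obtain ⟨x, hx⟩ : ∃ x, eval x r ≠ 0 := by
    by_contra! h
    exact hr (MvPolynomial.funext fun x => by simpa using h x)
  set R := restrictToLine r (x - a) a with hR
  have hR0 : R ≠ 0 := fun h => hx (by
    have := eval_restrictToLine r (x - a) a 1
    rw [← hR, h] at this
    simpa using this.symm)
  have hlim : Filter.Tendsto (fun s : ℝ => fun i => s * (x - a) i + a i)
      (nhdsWithin 0 {0}ᶜ) (nhds a) := by
    have : Continuous fun s : ℝ => fun i => s * (x - a) i + a i := by fun_prop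
    have h := (this.tendsto 0).mono_left (nhdsWithin_le_nhds (s := {0}ᶜ))
    simpa using h
  refine mem_closure_of_tendsto hlim ?_
  have hfin : ∀ᶠ s in nhdsWithin (0 : ℝ) {0}ᶜ, s ∉ R.roots.toFinset \ {0} := by
    refine nhdsWithin_le_nhds ?_
    exact (Finset.finite_toSet _).isClosed.isOpen_compl.mem_nhds (by simp)
  filter_upwards [hfin, self_mem_nhdsWithin] with s hs hs0
  have h0 : s ≠ 0 := hs0
  simp only [Finset.mem_sdiff, Multiset.mem_toFinset, Polynomial.mem_roots hR0,
    Finset.mem_singleton, h0, not_false_eq_true, and_true, Polynomial.IsRoot] at hs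
  rwa [hR, eval_restrictToLine] at hs

end Restriction

/-! ### Wronskians and common factors in one variable -/

namespace Polynomial

lemma ResidueNonneg.of_wronskian_nonneg {q p : ℝ[X]} (hcop : IsCoprime p (derivative p))
    (h : ∀ x : ℝ, 0 ≤ (derivative p * q - p * derivative q).eval x) : ResidueNonneg q p := by
  intro a k p₁ hp ha
  have hpa : p.eval a = 0 := by rw [hp]; simp
  cases k with
  | zero =>
    refine ⟨q, by simp, ?_⟩
    have hd : (derivative p).eval a = p₁.eval a := by
      rw [hp]; simp [derivative_mul]
    have := h a
    rw [eval_sub, eval_mul, eval_mul, hpa, hd] at this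
    linarith
  | succ k =>
    exfalso
    have hd : (derivative p).eval a = 0 := by
      rw [hp, show k + 1 + 1 = k + 2 from rfl]; simp [derivative_mul, derivative_pow]
    obtain ⟨u, v, huv⟩ := hcop
    have := congrArg (eval a) huv
    simp [hpa, hd] at this

/-- At a root of `p₁` the product vanishes to order at least one more than `p₁`, and `q` loses at
most one order. -/
lemma ResidueNonneg.dvd_of_mul {q p₁ p₂ : ℝ[X]} (h : ResidueNonneg q (p₁ * p₂))
    (hs : p₁.Splits) (h0 : p₁ * p₂ ≠ 0) (hz : ∀ a, p₁.eval a = 0 → p₂.eval a = 0) : p₁ ∣ q := by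
  classical
  by_cases hq : q = 0
  · simp [hq]
  rw [hs.dvd_iff_roots_le_roots (left_ne_zero_of_mul h0) hq, Multiset.le_iff_count]
  intro a
  rw [count_roots, count_roots]
  by_cases ha : p₁.eval a = 0
  · obtain ⟨k, u, hu, hua⟩ := exists_pow_succ_X_sub_C_mul h0 (a := a) (by simp [ha])
    obtain ⟨q₁, hq₁, -⟩ := h a k u hu hua
    have h1 : k ≤ q.rootMultiplicity a := (le_rootMultiplicity_iff hq).mpr ⟨q₁, hq₁⟩
    have h2 : 0 < p₂.rootMultiplicity a :=
      (rootMultiplicity_pos (right_ne_zero_of_mul h0)).mpr (hz a ha)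
    have h3 := rootMultiplicity_mul (x := a) h0
    have h4 : (p₁ * p₂).rootMultiplicity a = k + 1 := by
      obtain ⟨v, hv, hva⟩ := (p₁ * p₂).exists_eq_pow_rootMultiplicity_mul_and_not_dvd h0 a
      exact (pow_X_sub_C_mul_unique (hv.symm.trans hu)
        (fun h => hva (dvd_iff_isRoot.mpr h)) hua).1
    omega
  · rw [rootMultiplicity_eq_zero (by simpa using ha)]
    exact Nat.zero_le _

lemma Splits.aeval_ne_zero_of_im_pos {p : ℝ[X]} (hs : p.Splits) (hp : p ≠ 0) {z : ℂ}
    (hz : 0 < z.im) : aeval z p ≠ 0 := by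
  obtain ⟨α, -, hα⟩ := hs.exists_monotone rfl
  rw [hα, map_mul, map_prod, aeval_C]
  refine mul_ne_zero (by simpa using hp) (Finset.prod_ne_zero_iff.mpr fun i _ h => ?_)
  have := congrArg Complex.im h
  simp at this
  exact hz.ne' this

lemma halfPlaneNonpos_mul_left_iff {f q p : ℝ[X]} (hs : f.Splits) (hf : f ≠ 0) :
    HalfPlaneNonpos (f * q) (f * p) ↔ HalfPlaneNonpos q p := by
  refine forall₂_congr fun z hz => ?_
  have e : aeval z (f * q) * (starRingEnd ℂ) (aeval z (f * p)) =
      ((Complex.normSq (aeval z f) : ℝ) : ℂ) * (aeval z q * (starRingEnd ℂ) (aeval z p)) := by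
    rw [← Complex.mul_conj, map_mul, map_mul, map_mul]
    ring
  have h0 : 0 < Complex.normSq (aeval z f) :=
    Complex.normSq_pos.mpr (hs.aeval_ne_zero_of_im_pos hf hz)
  rw [e, Complex.im_ofReal_mul]
  exact ⟨fun h => nonpos_of_mul_nonpos_right h h0,
    fun h => mul_nonpos_of_nonneg_of_nonpos h0.le h⟩

end Polynomial

/-! ### The cone of interlacers -/

section Interlacers

open Polynomial (HalfPlaneNonpos)

variable {n : ℕ}

lemma mem_interlacers_iff {d : ℕ} (hd : 1 ≤ d) {f : MvPolynomial (Fin n) ℝ} {e : Fin n → ℝ}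
    (hf : f.IsHomogeneous d) (hhyp : IsHyperbolic f e) (hpos : 0 < eval e f)
    {g : MvPolynomial (Fin n) ℝ} :
    g ∈ interlacers f e ↔ g.IsHomogeneous (d - 1) ∧
      (∀ a, HalfPlaneNonpos (restrictToLine g e a) (restrictToLine f e a)) ∧ 0 < eval e g := by
  have hf0 : f ≠ 0 := by rintro rfl; simp at hpos
  change (g.IsHomogeneous (f.totalDegree - 1) ∧ _) ∧ _ ↔ _
  rw [hf.totalDegree hf0, and_assoc]
  refine and_congr_right fun hg => and_congr_left fun hge => forall_congr' fun a => ?_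
  refine Polynomial.univInterlaces_iff_halfPlaneNonpos (m := d - 1) (hhyp.2.2 a) ?_
    (hg.natDegree_restrictToLine hge.ne' a) ?_ ?_
  · rw [hf.natDegree_restrictToLine hpos.ne' a]; omega
  · rwa [hf.leadingCoeff_restrictToLine hpos.ne' a]
  · rwa [hg.leadingCoeff_restrictToLine hge.ne' a]

lemma degree_restrictToLine_lt {d : ℕ} (hd : 1 ≤ d) {f g : MvPolynomial (Fin n) ℝ}
    {e : Fin n → ℝ} (hf : f.IsHomogeneous d) (hpos : eval e f ≠ 0)
    (hg : g.IsHomogeneous (d - 1)) (a : Fin n → ℝ) :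
    (restrictToLine g e a).degree < (restrictToLine f e a).degree := by
  rw [Polynomial.degree_eq_natDegree (hf.restrictToLine_ne_zero hpos a),
    hf.natDegree_restrictToLine hpos a]
  refine (Polynomial.degree_le_of_natDegree_le (hg.natDegree_restrictToLine_le e a)).trans_lt ?_
  exact_mod_cast (by omega : d - 1 < d)

lemma quotientComb_of_halfPlaneNonpos {d : ℕ} (hd : 1 ≤ d) {f g : MvPolynomial (Fin n) ℝ}
    {e : Fin n → ℝ} (hf : f.IsHomogeneous d) (hhyp : IsHyperbolic f e)
    (hg : g.IsHomogeneous (d - 1)) {a : Fin n → ℝ}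
    (h : HalfPlaneNonpos (restrictToLine g e a) (restrictToLine f e a)) :
    Polynomial.QuotientComb (restrictToLine g e a) (restrictToLine f e a) :=
  h.residueNonneg.quotientComb (hhyp.2.2 a) (degree_restrictToLine_lt hd hf hhyp.2.1 hg a)

lemma eval_nonneg_of_halfPlaneNonpos {d : ℕ} (hd : 1 ≤ d) {f g : MvPolynomial (Fin n) ℝ}
    {e : Fin n → ℝ} (hf : f.IsHomogeneous d) (hhyp : IsHyperbolic f e) (hpos : 0 < eval e f)
    (hg : g.IsHomogeneous (d - 1))
    (h : ∀ a, HalfPlaneNonpos (restrictToLine g e a) (restrictToLine f e a)) :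
    0 ≤ eval e g ∧ (eval e g = 0 → g = 0) := by
  have key : ∀ a, 0 ≤ eval e g ∧ (eval e g = 0 → restrictToLine g e a = 0) := by
    intro a
    have := (quotientComb_of_halfPlaneNonpos hd hf hhyp hg (h a)).coeff_mul_leadingCoeff
      (n := d - 1) (by rw [hf.natDegree_restrictToLine hpos.ne' a]; omega)
    rw [hg.coeff_restrictToLine, hf.leadingCoeff_restrictToLine hpos.ne'] at this
    exact ⟨nonneg_of_mul_nonneg_left this.1 hpos, this.2⟩
  refine ⟨(key 0).1, fun h0 => MvPolynomial.funext fun x => ?_⟩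
  have := eval_restrictToLine g e x 0
  rw [(key x).2 h0] at this
  simpa using this.symm

lemma mem_interlacerCone_iff {d : ℕ} (hd : 1 ≤ d) {f : MvPolynomial (Fin n) ℝ} {e : Fin n → ℝ}
    (hf : f.IsHomogeneous d) (hhyp : IsHyperbolic f e) (hpos : 0 < eval e f)
    {g : MvPolynomial (Fin n) ℝ} :
    g ∈ interlacerCone f e ↔ g.IsHomogeneous (d - 1) ∧
      ∀ a, HalfPlaneNonpos (restrictToLine g e a) (restrictToLine f e a) := by
  rw [interlacerCone, Set.mem_insert_iff, mem_interlacers_iff hd hf hhyp hpos]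
  constructor
  · rintro (rfl | h)
    · exact ⟨isHomogeneous_zero _ _ _, fun a z _ => by simp [restrictToLine]⟩
    · exact ⟨h.1, h.2.1⟩
  · rintro ⟨hg, h⟩
    obtain ⟨h1, h2⟩ := eval_nonneg_of_halfPlaneNonpos hd hf hhyp hpos hg h
    rcases h1.eq_or_lt with h1 | h1
    · exact .inl (h2 h1.symm)
    · exact .inr ⟨hg, h, h1⟩

lemma Forms.continuous_aeval (k : ℕ) (w : Fin n → ℂ) :
    Continuous fun g : Forms n k => aeval w (g : MvPolynomial (Fin n) ℝ) := by
  have e : ∀ g : Forms n k, aeval w (g : MvPolynomial (Fin n) ℝ) =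
      ∑ m ∈ Finset.finsuppAntidiag Finset.univ k,
        ((coeff m (g : MvPolynomial (Fin n) ℝ) : ℝ) : ℂ) * ∏ i, w i ^ m i := by
    intro g
    rw [aeval_def, eval₂_eq']
    refine Finset.sum_subset (fun m hm => ?_) fun m _ hm => ?_
    · rw [Finset.mem_finsuppAntidiag]
      exact ⟨IsHomogeneous.sum_exponents g.2 hm, Finset.subset_univ _⟩
    · rw [notMem_support_iff.mp hm]; simp
  simp_rw [e]
  refine continuous_finsetSum _ fun m _ => ?_
  have h1 : Continuous fun (p : Forms n k) (m : Fin n →₀ ℕ) =>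
    coeff m (p : MvPolynomial (Fin n) ℝ) := continuous_induced_dom
  have h2 := (continuous_apply m).comp h1
  exact (Complex.continuous_ofReal.comp h2).mul continuous_const

/-- The interlacer cone, as a convex cone in the space of forms. -/
noncomputable def interlacerPointedCone (f : MvPolynomial (Fin n) ℝ) (e : Fin n → ℝ) (k : ℕ) :
    PointedCone ℝ (Forms n k) where
  carrier := {g | ∀ a, HalfPlaneNonpos (restrictToLine (g : MvPolynomial (Fin n) ℝ) e a)
    (restrictToLine f e a)}
  add_mem' := by
    intro g h hg hh a z hz
    have h1 := hg a z hz
    have h2 := hh a z hz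
    rw [Submodule.coe_add]
    simp only [restrictToLine, map_add, add_mul, Complex.add_im] at h1 h2 ⊢
    exact add_nonpos h1 h2
  zero_mem' := by
    intro a z hz
    simp [restrictToLine]
  smul_mem' := by
    intro c g hg a z hz
    have h1 := hg a z hz
    have e1 : ((c • g : Forms n k) : MvPolynomial (Fin n) ℝ) =
      (c : ℝ) • (g : MvPolynomial (Fin n) ℝ) := rfl
    rw [e1]
    simp only [restrictToLine, map_smul, Complex.real_smul, mul_assoc, Complex.im_ofReal_mul]
      at h1 ⊢
    exact mul_nonpos_of_nonneg_of_nonpos c.2 h1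

lemma isClosed_interlacerPointedCone (f : MvPolynomial (Fin n) ℝ) (e : Fin n → ℝ) (k : ℕ) :
    IsClosed (interlacerPointedCone f e k : Set (Forms n k)) := by
  have : (interlacerPointedCone f e k : Set (Forms n k)) =
      ⋂ (a : Fin n → ℝ) (z : ℂ) (_ : 0 < z.im), {g : Forms n k |
        (aeval (fun i => z * e i + a i) (g : MvPolynomial (Fin n) ℝ) *
          (starRingEnd ℂ) (Polynomial.aeval z (restrictToLine f e a))).im ≤ 0} := by
    ext g
    simp only [Set.mem_iInter, ← aeval_restrictToLine]
    exact Iff.rfl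
  rw [this]
  refine isClosed_iInter fun a => isClosed_iInter fun z => isClosed_iInter fun _ => ?_
  exact isClosed_le (Complex.continuous_im.comp
    ((Forms.continuous_aeval k _).mul continuous_const)) continuous_const

lemma restrictToLine_wronskian (f h : MvPolynomial (Fin n) ℝ) (e a : Fin n → ℝ) :
    restrictToLine (dirDeriv e f * h - f * dirDeriv e h) e a =
      Polynomial.derivative (restrictToLine f e a) * restrictToLine h e a -
        restrictToLine f e a * Polynomial.derivative (restrictToLine h e a) := by
  rw [← restrictToLine_dirDeriv, ← restrictToLine_dirDeriv]
  simp [restrictToLine]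

/-- Closedness in the base point `a`, needed to pass from generic lines to all lines. -/
lemma isClosed_setOf_halfPlaneNonpos (f h : MvPolynomial (Fin n) ℝ) (e : Fin n → ℝ) :
    IsClosed {a | HalfPlaneNonpos (restrictToLine h e a) (restrictToLine f e a)} := by
  have hc : ∀ (g : MvPolynomial (Fin n) ℝ) (z : ℂ), Continuous fun a : Fin n → ℝ =>
      Polynomial.aeval z (restrictToLine g e a) := by
    intro g z
    have e1 : ∀ a : Fin n → ℝ, Polynomial.aeval z (restrictToLine g e a) =
        eval (fun i => z * e i + a i) (map (algebraMap ℝ ℂ) g) := fun a => by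
      rw [aeval_restrictToLine, eval_map, aeval_def]
    simp_rw [e1]
    exact (MvPolynomial.continuous_eval _).comp (by fun_prop)
  simp only [HalfPlaneNonpos, Set.ofPred_forall]
  refine isClosed_iInter fun z => isClosed_iInter fun _ => ?_
  exact isClosed_le (Complex.continuous_im.comp
    ((hc h z).mul (Complex.continuous_conj.comp (hc f z)))) continuous_const

lemma halfPlaneNonpos_of_wronskian_nonneg {d : ℕ} (hd : 1 ≤ d) {f h : MvPolynomial (Fin n) ℝ}
    {e : Fin n → ℝ} (hf : f.IsHomogeneous d) (hhyp : IsHyperbolic f e) (hsq : Squarefree f)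
    (hh : h.IsHomogeneous (d - 1))
    (hW : ∀ x, 0 ≤ eval x (dirDeriv e f * h - f * dirDeriv e h)) (a : Fin n → ℝ) :
    HalfPlaneNonpos (restrictToLine h e a) (restrictToLine f e a) := by
  obtain ⟨r, hr, hcop⟩ := exists_generic_isCoprime_derivative hf hhyp.2.1 hsq
  have hsub : {a : Fin n → ℝ | eval a r ≠ 0} ⊆
      {a | HalfPlaneNonpos (restrictToLine h e a) (restrictToLine f e a)} := by
    intro b hb
    refine ((Polynomial.ResidueNonneg.of_wronskian_nonneg (hcop b hb) fun x => ?_).quotientComb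
      (hhyp.2.2 b) (degree_restrictToLine_lt hd hf hhyp.2.1 hh b)).halfPlaneNonpos
    rw [← restrictToLine_wronskian, eval_restrictToLine]
    exact hW _
  have := (isClosed_setOf_halfPlaneNonpos f h e).closure_subset_iff.mpr hsub
  rw [(dense_eval_ne_zero hr).closure_eq] at this
  exact this (Set.mem_univ a)

lemma interlacerCone_eq_of_squarefree {d : ℕ} (hd : 1 ≤ d) {f : MvPolynomial (Fin n) ℝ}
    {e : Fin n → ℝ} (hf : f.IsHomogeneous d) (hhyp : IsHyperbolic f e) (hpos : 0 < eval e f)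
    (hsq : Squarefree f) :
    interlacerCone f e = {h | h.IsHomogeneous (d - 1) ∧
      ∀ x : Fin n → ℝ, 0 ≤ eval x (dirDeriv e f * h - f * dirDeriv e h)} := by
  ext h
  rw [mem_interlacerCone_iff hd hf hhyp hpos]
  refine and_congr_right fun hh =>
    ⟨fun H x => ?_, halfPlaneNonpos_of_wronskian_nonneg hd hf hhyp hsq hh⟩
  -- The point `x` is the parameter value `0` on the line through `x`.
  have := (quotientComb_of_halfPlaneNonpos hd hf hhyp hh (H x)).wronskian_nonneg 0
  rw [← restrictToLine_wronskian, eval_restrictToLine] at this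
  simpa using this

lemma MvPolynomial.IsHomogeneous.dirDeriv {f : MvPolynomial (Fin n) ℝ} {d : ℕ}
    (hf : f.IsHomogeneous d) (e : Fin n → ℝ) : (dirDeriv e f).IsHomogeneous (d - 1) :=
  IsHomogeneous.sum _ _ _ fun i _ => by
    rw [smul_eq_C_mul]
    exact hf.pderiv.C_mul _

lemma dirDeriv_add (e : Fin n → ℝ) (f g : MvPolynomial (Fin n) ℝ) :
    dirDeriv e (f + g) = dirDeriv e f + dirDeriv e g := by
  simp [dirDeriv, Finset.sum_add_distrib]

lemma dirDeriv_smul (e : Fin n → ℝ) (c : ℝ) (f : MvPolynomial (Fin n) ℝ) :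
    dirDeriv e (c • f) = c • dirDeriv e f := by
  simp only [dirDeriv, Finset.smul_sum]
  exact Finset.sum_congr rfl fun i _ => by rw [Derivation.map_smul, smul_comm]

lemma wronskian_isHomogeneous {d : ℕ} (hd : 1 ≤ d) {f h : MvPolynomial (Fin n) ℝ}
    (hf : f.IsHomogeneous d) (hh : h.IsHomogeneous (d - 1)) (e : Fin n → ℝ) :
    (dirDeriv e f * h - f * dirDeriv e h).IsHomogeneous (2 * d - 2) := by
  have h1 : (dirDeriv e f * h).IsHomogeneous (2 * d - 2) := by
    have := (hf.dirDeriv e).mul hh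
    rwa [show d - 1 + (d - 1) = 2 * d - 2 by omega] at this
  refine h1.sub ?_
  -- For `d = 1` truncated subtraction breaks the degree count of `f * D_e h`, but then `h` is
  -- constant and the term vanishes.
  obtain rfl | hd2 := hd.eq_or_lt
  · have hc := totalDegree_eq_zero_iff_eq_C.mp (Nat.le_zero.mp hh.totalDegree_le)
    have : dirDeriv e h = 0 := by rw [hc]; simp [dirDeriv]
    rw [this, mul_zero]
    exact isHomogeneous_zero _ _ _
  · have := hf.mul (hh.dirDeriv e)
    rwa [show d + (d - 1 - 1) = 2 * d - 2 by omega] at this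

/-- The map `h ↦ D_e f · h - f · D_e h` on forms of degree `d - 1`. -/
noncomputable def wronskianMap {d : ℕ} (hd : 1 ≤ d) {f : MvPolynomial (Fin n) ℝ}
    (hf : f.IsHomogeneous d) (e : Fin n → ℝ) : Forms n (d - 1) →ₗ[ℝ] Forms n (2 * d - 2) where
  toFun h := ⟨dirDeriv e f * (h : MvPolynomial (Fin n) ℝ) - f * dirDeriv e h,
    wronskian_isHomogeneous hd hf h.2 e⟩
  map_add' g h := by
    ext1
    simp only [Submodule.coe_add, dirDeriv_add]
    ring
  map_smul' c h := by
    ext1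
    simp only [Submodule.coe_smul, dirDeriv_smul, RingHom.id_apply, mul_smul_comm, smul_sub]

lemma wronskianMap_injective {d : ℕ} (hd : 1 ≤ d) {f : MvPolynomial (Fin n) ℝ}
    (hf : f.IsHomogeneous d) {e : Fin n → ℝ} (hhyp : IsHyperbolic f e) (hpos : 0 < eval e f)
    (hsq : Squarefree f) : Function.Injective (wronskianMap hd hf e) := by
  rw [injective_iff_map_eq_zero]
  have key : ∀ h : Forms n (d - 1), wronskianMap hd hf e h = 0 →
      0 ≤ eval e (h : MvPolynomial (Fin n) ℝ) ∧
        (eval e (h : MvPolynomial (Fin n) ℝ) = 0 → (h : MvPolynomial (Fin n) ℝ) = 0) := by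
    intro h h0
    refine eval_nonneg_of_halfPlaneNonpos hd hf hhyp hpos h.2
      (halfPlaneNonpos_of_wronskian_nonneg hd hf hhyp hsq h.2 fun x => ?_)
    have : dirDeriv e f * (h : MvPolynomial (Fin n) ℝ) - f * dirDeriv e h = 0 :=
      congrArg Subtype.val h0
    rw [this, map_zero]
  intro h h0
  have h1 := (key h h0).1
  have h2 := (key (-h) (by rw [map_neg, h0, neg_zero])).1
  rw [Submodule.coe_neg, map_neg] at h2
  exact Subtype.ext ((key h h0).2 (by linarith))

lemma image_wronskianMap {d : ℕ} (hd : 1 ≤ d) {f : MvPolynomial (Fin n) ℝ}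
    (hf : f.IsHomogeneous d) {e : Fin n → ℝ} (hhyp : IsHyperbolic f e) (hpos : 0 < eval e f)
    (hsq : Squarefree f) :
    wronskianMap hd hf e '' {h | (h : MvPolynomial (Fin n) ℝ) ∈ interlacerCone f e} =
      nonnegForms n (2 * d - 2) ∩
        (LinearMap.range (wronskianMap hd hf e) : Set (Forms n (2 * d - 2))) := by
  rw [interlacerCone_eq_of_squarefree hd hf hhyp hpos hsq]
  ext p
  constructor
  · rintro ⟨h, hh, rfl⟩
    exact ⟨hh.2, h, rfl⟩
  · rintro ⟨hp, h, rfl⟩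
    exact ⟨h, ⟨h.2, hp⟩, rfl⟩

/-- If an injective linear map carries a set of forms onto a section of the cone of nonnegative
forms, then every multiple of that set by a fixed polynomial is isomorphic to this section. -/
lemma isIsoToNonnegSection_image_mul {k l : ℕ} {f : MvPolynomial (Fin n) ℝ} (hf : f ≠ 0)
    {S : Set (MvPolynomial (Fin n) ℝ)} (hS : ∀ h ∈ S, h.IsHomogeneous k)
    {Φ : Forms n k →ₗ[ℝ] Forms n l} (hΦ : Function.Injective Φ) {L : Submodule ℝ (Forms n l)}
    (himg : Φ '' {h | (h : MvPolynomial (Fin n) ℝ) ∈ S} =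
      nonnegForms n l ∩ (L : Set (Forms n l))) :
    IsIsoToNonnegSection ((fun h => f * h) '' S) l := by
  set M : Forms n k →ₗ[ℝ] MvPolynomial (Fin n) ℝ :=
    (LinearMap.mulLeft ℝ f).comp (Submodule.subtype _) with hM
  have hMinj : Function.Injective M := fun g h hgh =>
    Subtype.ext (mul_left_cancel₀ hf hgh)
  -- The span consists of multiples of `f`, so division by `f` is a linear map on it.
  have hspan : Submodule.span ℝ ((fun h => f * h) '' S) ≤ LinearMap.range M := by
    rw [Submodule.span_le]
    rintro _ ⟨h, hh, rfl⟩
    exact ⟨⟨h, hS h hh⟩, rfl⟩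
  set E := LinearEquiv.ofInjective M hMinj
  refine ⟨L, Φ.comp (E.symm.toLinearMap.comp (Submodule.inclusion hspan)), ?_, ?_⟩
  · exact hΦ.comp (E.symm.injective.comp (Submodule.inclusion_injective hspan))
  · rw [← himg]
    ext p
    constructor
    · rintro ⟨⟨_, hs⟩, ⟨h, hh, rfl⟩, rfl⟩
      refine ⟨⟨h, hS h hh⟩, hh, ?_⟩
      have : E.symm (Submodule.inclusion hspan ⟨f * h, hs⟩) = ⟨h, hS h hh⟩ := by
        rw [LinearEquiv.symm_apply_eq]; rfl
      exact congrArg Φ this.symm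
    · rintro ⟨h, hh, rfl⟩
      refine ⟨⟨f * h, Submodule.subset_span ⟨h, hh, rfl⟩⟩, ⟨h, hh, rfl⟩, ?_⟩
      have : E.symm (Submodule.inclusion hspan ⟨f * h, Submodule.subset_span ⟨h, hh, rfl⟩⟩) =
          h := by
        rw [LinearEquiv.symm_apply_eq]; rfl
      exact congrArg Φ this

lemma isHomogeneous_of_mem_interlacerCone {d : ℕ} (hd : 1 ≤ d) {f : MvPolynomial (Fin n) ℝ}
    {e : Fin n → ℝ} (hf : f.IsHomogeneous d) (hhyp : IsHyperbolic f e) (hpos : 0 < eval e f)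
    {h : MvPolynomial (Fin n) ℝ} (hh : h ∈ interlacerCone f e) : h.IsHomogeneous (d - 1) :=
  ((mem_interlacerCone_iff hd hf hhyp hpos).mp hh).1

/-- Division of `g(te + x)` by the monic multiple of `f(te + x)` commutes with setting `x = a`. The
remainder vanishes for every `a`, hence identically; then put `t = 0`. -/
lemma dvd_of_forall_restrictToLine_dvd {f g : MvPolynomial (Fin n) ℝ} {d : ℕ}
    (hf : f.IsHomogeneous d) {e : Fin n → ℝ} (he : eval e f ≠ 0)
    (h : ∀ a, restrictToLine f e a ∣ restrictToLine g e a) : f ∣ g := by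
  have hP := monicRestriction_monic hf he
  have hr : genericRestriction e g %ₘ monicRestriction e f = 0 := by
    ext1 i
    refine MvPolynomial.funext fun a => ?_
    have : (genericRestriction e g %ₘ monicRestriction e f).map (eval a) = 0 := by
      rw [Polynomial.map_modByMonic _ hP, Polynomial.modByMonic_eq_zero_iff_dvd (hP.map _),
        map_genericRestriction, map_monicRestriction]
      have hu : IsUnit (Polynomial.C (eval e f)⁻¹) :=
        Polynomial.isUnit_C.mpr (inv_ne_zero he).isUnit
      exact hu.mul_left_dvd.mpr (h a)
    rw [← Polynomial.coeff_map, this, Polynomial.coeff_zero, Polynomial.coeff_zero, map_zero]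
  have hdvd := map_dvd (Polynomial.evalRingHom (0 : MvPolynomial (Fin n) ℝ))
    ((Polynomial.modByMonic_eq_zero_iff_dvd hP).mp hr)
  rw [monicRestriction, map_mul, Polynomial.coe_evalRingHom, eval_zero_genericRestriction,
    eval_zero_genericRestriction] at hdvd
  exact (dvd_mul_left _ _).trans hdvd

lemma eval_eq_zero_of_complexZeros_eq {f g : MvPolynomial (Fin n) ℝ}
    (h : complexZeros f = complexZeros g) {x : Fin n → ℝ} (hx : eval x f = 0) :
    eval x g = 0 := by
  have e : ∀ p : MvPolynomial (Fin n) ℝ,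
      aeval (fun i => (x i : ℂ)) p = ((eval x p : ℝ) : ℂ) := fun p => by
    have := aeval_algebraMap_apply ℂ x p
    simpa [Function.comp_def] using this
  have : (fun i => (x i : ℂ)) ∈ complexZeros f := by
    change aeval _ f = 0
    rw [e, hx, Complex.ofReal_zero]
  rw [h] at this
  have h2 : aeval (fun i => (x i : ℂ)) g = 0 := this
  rwa [e, Complex.ofReal_eq_zero] at h2

lemma IsHyperbolic.of_mul {f₁ f₂ : MvPolynomial (Fin n) ℝ} {d k : ℕ} {e : Fin n → ℝ}
    (hhyp : IsHyperbolic (f₁ * f₂) e) (hf : (f₁ * f₂).IsHomogeneous d)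
    (h₂ : f₂.IsHomogeneous k) : IsHyperbolic f₂ e := by
  refine ⟨⟨k, h₂⟩, fun h => hhyp.2.1 (by rw [map_mul, h, mul_zero]), fun a => ?_⟩
  refine (hhyp.2.2 a).of_dvd (hf.restrictToLine_ne_zero hhyp.2.1 a) ?_
  rw [restrictToLine_mul]
  exact dvd_mul_left _ _

lemma interlacers_mul_eq {d₁ d₂ : ℕ} (hd₂ : 1 ≤ d₂) {f₁ f₂ : MvPolynomial (Fin n) ℝ}
    {e : Fin n → ℝ} (h₁ : f₁.IsHomogeneous d₁) (h₂ : f₂.IsHomogeneous d₂)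
    (hhyp : IsHyperbolic (f₁ * f₂) e) (hpos₁ : 0 < eval e f₁) (hpos₂ : 0 < eval e f₂)
    (hz : ∀ x, eval x f₁ = 0 → eval x f₂ = 0) :
    interlacers (f₁ * f₂) e = (fun h => f₁ * h) '' interlacers f₂ e := by
  have hf := h₁.mul h₂
  have hhyp₂ := hhyp.of_mul hf h₂
  have hhyp₁ : IsHyperbolic f₁ e := by
    rw [mul_comm] at hhyp hf
    exact hhyp.of_mul hf h₁
  have hpos : 0 < eval e (f₁ * f₂) := by rw [map_mul]; exact mul_pos hpos₁ hpos₂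
  have hd : 1 ≤ d₁ + d₂ := by omega
  have hf₁ : f₁ ≠ 0 := by rintro rfl; simp at hpos₁
  have hHP : ∀ h a, HalfPlaneNonpos (restrictToLine (f₁ * h) e a)
      (restrictToLine (f₁ * f₂) e a) ↔
      HalfPlaneNonpos (restrictToLine h e a) (restrictToLine f₂ e a) := fun h a => by
    rw [restrictToLine_mul, restrictToLine_mul]
    exact Polynomial.halfPlaneNonpos_mul_left_iff (hhyp₁.2.2 a)
      (h₁.restrictToLine_ne_zero hpos₁.ne' a)
  ext g
  constructor
  · intro hg
    obtain ⟨hgh, hg1, hg2⟩ := (mem_interlacers_iff hd hf hhyp hpos).mp hg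
    obtain ⟨h, rfl⟩ : f₁ ∣ g := by
      refine dvd_of_forall_restrictToLine_dvd h₁ hpos₁.ne' fun a => ?_
      have h3 := (hg1 a).residueNonneg
      have h4 := hf.restrictToLine_ne_zero hpos.ne' a
      rw [restrictToLine_mul] at h3 h4
      refine h3.dvd_of_mul (hhyp₁.2.2 a) h4 fun t ht => ?_
      rw [eval_restrictToLine] at ht ⊢
      exact hz _ ht
    refine ⟨h, (mem_interlacers_iff hd₂ h₂ hhyp₂ hpos₂).mpr
      ⟨?_, fun a => (hHP h a).mp (hg1 a), ?_⟩, rfl⟩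
    · have h0 : f₁ * h ≠ 0 := by intro h0; rw [h0] at hg2; simp at hg2
      obtain ⟨k, l, hk, hl, hkl⟩ := hgh.of_mul h0
      have := hk.inj_right h₁ hf₁
      rwa [show d₂ - 1 = l by omega]
    · rw [map_mul] at hg2
      exact (pos_iff_pos_of_mul_pos hg2).mp hpos₁
  · rintro ⟨h, hh, rfl⟩
    obtain ⟨hh1, hh2, hh3⟩ := (mem_interlacers_iff hd₂ h₂ hhyp₂ hpos₂).mp hh
    refine (mem_interlacers_iff hd hf hhyp hpos).mpr ⟨?_, fun a => (hHP h a).mpr (hh2 a), ?_⟩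
    · have := h₁.mul hh1
      rwa [show d₁ + (d₂ - 1) = d₁ + d₂ - 1 by omega] at this
    · rw [map_mul]; exact mul_pos hpos₁ hh3

end Interlacers

theorem corollary2p7 (n d : ℕ) (hd : 1 ≤ d) (f : MvPolynomial (Fin n) ℝ) (e : Fin n → ℝ)
    (hf : f.IsHomogeneous d) (hhyp : IsHyperbolic f e) (hpos : 0 < eval e f) :
    -- `Int(f, e)`, with its apex, is a closed convex cone in `ℝ[x]_{d-1}`
    (∃ K : PointedCone ℝ (Forms n (d - 1)),
      ((↑) : Forms n (d - 1) → MvPolynomial (Fin n) ℝ) '' (K : Set (Forms n (d - 1))) =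
        interlacerCone f e ∧
      IsClosed (K : Set (Forms n (d - 1)))) ∧
    -- the square-free case
    (Squarefree f →
      interlacerCone f e =
        {h | h.IsHomogeneous (d - 1) ∧
          ∀ x : Fin n → ℝ, 0 ≤ eval x (dirDeriv e f * h - f * dirDeriv e h)} ∧
      (∃ Φ : Forms n (d - 1) →ₗ[ℝ] Forms n (2 * d - 2),
        (∀ h : Forms n (d - 1), (Φ h : MvPolynomial (Fin n) ℝ) =
          dirDeriv e f * (h : MvPolynomial (Fin n) ℝ) - f * dirDeriv e h) ∧
        Function.Injective Φ ∧
        Φ '' {h | (h : MvPolynomial (Fin n) ℝ) ∈ interlacerCone f e} =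
          nonnegForms n (2 * d - 2) ∩ (LinearMap.range Φ : Set (Forms n (2 * d - 2)))) ∧
      IsIsoToNonnegSection (interlacerCone f e) (2 * d - 2)) ∧
    -- the general case
    (∀ f₁ f₂ : MvPolynomial (Fin n) ℝ, f = f₁ * f₂ → complexZeros f = complexZeros f₂ →
      Squarefree f₂ → 0 < eval e f₂ →
      interlacers f e = (fun h => f₁ * h) '' interlacers f₂ e ∧
      interlacerCone f e = (fun h => f₁ * h) '' interlacerCone f₂ e ∧
      IsIsoToNonnegSection (interlacerCone f e) (2 * f₂.totalDegree - 2)) := by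
  refine ⟨⟨interlacerPointedCone f e (d - 1), ?_, isClosed_interlacerPointedCone f e _⟩,
    fun hsq => ⟨interlacerCone_eq_of_squarefree hd hf hhyp hpos hsq,
      ⟨wronskianMap hd hf e, fun _ => rfl, wronskianMap_injective hd hf hhyp hpos hsq,
        image_wronskianMap hd hf hhyp hpos hsq⟩, ?_⟩, ?_⟩
  · ext g
    rw [mem_interlacerCone_iff hd hf hhyp hpos]
    constructor
    · rintro ⟨g, hg, rfl⟩
      exact ⟨g.2, hg⟩
    · rintro ⟨hg, h⟩
      exact ⟨⟨g, hg⟩, h, rfl⟩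
  · have := isIsoToNonnegSection_image_mul one_ne_zero
      (fun h => isHomogeneous_of_mem_interlacerCone hd hf hhyp hpos)
      (wronskianMap_injective hd hf hhyp hpos hsq) (image_wronskianMap hd hf hhyp hpos hsq)
    simpa using this
  · rintro f₁ f₂ rfl hV hsq hpos₂
    have h0 : f₁ * f₂ ≠ 0 := by intro h0; rw [h0] at hpos; simp at hpos
    obtain ⟨d₁, d₂, h₁, h₂, hdd⟩ := hf.of_mul h0
    have hpos₁ : 0 < eval e f₁ := by
      rw [map_mul] at hpos
      exact (pos_iff_pos_of_mul_pos hpos).mpr hpos₂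
    have hzero : ∀ x, eval x (f₁ * f₂) = 0 → eval x f₂ = 0 :=
      fun x => eval_eq_zero_of_complexZeros_eq hV
    -- Since `d ≥ 1`, the form `f` vanishes at the origin; so does `f₂`, which is therefore not a
    -- positive constant.
    have hd₂ : 1 ≤ d₂ := by
      by_contra! hlt
      have hd0 : d₂ = 0 := by omega
      subst hd0
      have hc := totalDegree_eq_zero_iff_eq_C.mp (Nat.le_zero.mp h₂.totalDegree_le)
      have hz := hf.restrictToLine_zero e
      have h3 := eval_restrictToLine (f₁ * f₂) e 0 0
      rw [hz] at h3
      have h4 := hzero 0 (by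
        simp only [zero_mul, Pi.zero_apply, add_zero] at h3
        rw [show (0 : Fin n → ℝ) = fun _ => 0 from rfl, ← h3]
        simp [zero_pow (by omega : d ≠ 0)])
      rw [hc, eval_C] at h4 hpos₂
      exact hpos₂.ne' h4
    have hint := interlacers_mul_eq hd₂ h₁ h₂ hhyp hpos₁ hpos₂ fun x hx =>
      hzero x (by rw [map_mul, hx, zero_mul])
    have hcone : interlacerCone (f₁ * f₂) e = (fun h => f₁ * h) '' interlacerCone f₂ e := by
      rw [interlacerCone, hint, interlacerCone, Set.image_insert_eq, mul_zero]
    have hhyp₂ := hhyp.of_mul hf h₂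
    refine ⟨hint, hcone, ?_⟩
    rw [hcone, h₂.totalDegree (right_ne_zero_of_mul h0)]
    exact isIsoToNonnegSection_image_mul (left_ne_zero_of_mul h0)
      (fun h => isHomogeneous_of_mem_interlacerCone hd₂ h₂ hhyp₂ hpos₂)
      (wronskianMap_injective hd₂ h₂ hhyp₂ hpos₂ hsq)
      (image_wronskianMap hd₂ h₂ hhyp₂ hpos₂ hsq)
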